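/- **Setting.** Let $N=[n]$ be a set of $n\ge 1$ agents, $O$ a finite set of items and $c$ a positive integer. Each agent $i$ has a valuation $v_i:2^O\to\mathbb R$. Write $\Delta_v(S,o)=v(S\cup\{o\})-v(S)$. A valuation $v$ is *$\{-1,0,c\}$-ONSUB* if * $v(\emptyset)=0$, and $\Delta_v(S,o)\ge\Delta_v(T,o)$ whenever $S\subseteq T\subseteq O$ and $o\in O\setminus T$; * $\Delta_v(S,o)\in\{-1,0,c\}$ whenever $o\in O\setminus S$; * (order-neutrality) for every $S\subseteq O$, the sorted vector $\vec v(S)$ of the $|S|$ marginal gains obtained by adding the items of $S$ one by one to $\emptyset$ does not depend on the order in which they are added. Let $\beta_i^\tau(S)$ be the number of entries of $\vec v_i(S)$ that are at least $\tau$. An allocation is a partition $X=(X_0,X_1,\dots,X_n)$ of $O$ into possibly empty bundles ($X_0$: unallocated items); it is complete if $X_0=\emptyset$. Its utilitarian social welfare is $\sum_{i\in N}v_i(X_i)$. For an allocation $X$ and set functions $\beta=(\beta_i)_{i\in N}$, let $F_{\beta_i}(X,i)=\{o\in O:\Delta_{\beta_i}(X_i,o)=1\}$. The exchange graph $\mathcal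 G(X,\beta)$ has vertex set $O$ and an edge $o\to o'$ if $o\in X_j$ and $\beta_j((X_j\setminus\{o\})\cup\{o'\})=\beta_j(X_j)$ for some $j\in N$. For allocations $X^c,X^0$, the weighted graph $\mathcal G^w(X^c,X^0,\beta)$ has the edges of $\mathcal G(X^c,\beta)$; an edge from an item of $X^c_h$ to an item of $X^0_h$, $h\in N$, has weight $\tfrac12$, and all other edges have weight $1$. The weight of a path is the sum of its edge weights. *Augmenting* $X$ for $i$ along a path $P=(o_1,\dots,o_t)$, $t\ge1$, replaces each $X_k$ by $(X_k\setminus\{o_t\})\oplus\{o_j,o_{j+1}:1\le j<t,\ o_j\in X_k\}$ (symmetric difference) and then adds $o_1$ to $X_i$. **Algorithm.** *Phase 1.* Run Yankee Swap with respect to $\beta^0$: start with $X=(O,\emptyset,\dots,\emptyset)$ and $U=N$. While $U\ne\emptyset$, pick $i\in U$ with $\beta^0_i(X_i)$ minimum. If $\mathcal G(X,\beta^0)$ has a path from $F_{\beta^0_i}(X,i)$ to $X_0$, augment $X$ for $i$ along a shortest such path; otherwise remove $i$ from $U$. Let $X^0$ be the final $X$, and set $X^c=X^{-1}=(O,\emptyset,\dots,\emptyset)$.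 *Phase 2.* Repeat the following two steps as long as at least one augmentation was done in the iteration. 1. While for some $i\in N$ there is a path from $F_{\beta^c_i}(X^c,i)$ to $X^c_0$ in $\mathcal G^w(X^c,X^0,\beta^c)$, choose such an $i$ and a minimum weight such path $P=(o_1,\dots,o_t)$. Here ties between paths consisting of a single item are broken in favour of items of $X^0_i$: if $t=1$ and $F_{\beta^c_i}(X^c,i)\cap X^0_i\neq\emptyset$, then $o_1\in X^0_i$. Augment $X^c$ for $i$ along $P$, remove $o_t$ from every $X^0_k$ with $k\in N$, and add it to $X^0_0$. 2. If for some $i,j\in N$ with $i\ne j$ there is a path from $F_{\beta^c_i}(X^c,i)$ to $X^c_j$ and either $|X^c_i|+1<|X^c_j|$, or $|X^c_i|+1=|X^c_j|$ and $i<j$, choose such $i,j$ and augment $X^c$ for $i$ along a minimum weight path from $F_{\beta^c_i}(X^c,i)$ to $X^c_j$ in $\mathcal G^w(X^c,X^0,\beta^c)$. *Phase 3.* While $X^c_0\cap X^0_0\cap X^{-1}_0\neq\emptyset$, let $i$ be the agent of largest index among those maximizing $v_h(X^c_h\cup X^0_h\cup X^{-1}_h)$, and move an arbitrary item of $X^c_0\cap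 X^0_0\cap X^{-1}_0$ from $X^{-1}_0$ to $X^{-1}_i$. Return the allocation that gives $X^c_h\cup X^0_h\cup X^{-1}_h$ to each agent $h\in N$. **Corollary.** If all $v_i$ are $\{-1,0,c\}$-ONSUB, then, however the choices left open are made, the algorithm terminates and outputs a complete allocation whose utilitarian social welfare is maximum among all complete allocations. -/

import Mathlib

namespace MixedManna

noncomputable section

variable {O : Type*} [DecidableEq O] {n : ℕ}

/-! ### Valuation functions -/

/-- The marginal utility `Δ_v(S, o) = v(S + o) - v(S)`. -/
def marginal (v : Finset O → ℝ) (S : Finset O) (o : O) : ℝ :=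
  v (insert o S) - v S

/-- Submodular functions: normalized, with decreasing marginal gains. -/
def IsSubmodular (v : Finset O → ℝ) : Prop :=
  v ∅ = 0 ∧ ∀ S T : Finset O, S ⊆ T → ∀ o, o ∉ T → marginal v T o ≤ marginal v S o

/-- `A`-SUB functions: submodular functions all of whose marginal gains lie in `A`. -/
def IsSub (A : Set ℝ) (v : Finset O → ℝ) : Prop :=
  IsSubmodular v ∧ ∀ (S : Finset O) (o : O), o ∉ S → marginal v S o ∈ A

/-- The marginal gains obtained when the items of a list are added one by one to the set `S`. -/
def gainsFrom (v : Finset O → ℝ) : Finset O → List O → List ℝ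
  | _, [] => []
  | S, o :: l => marginal v S o :: gainsFrom v (insert o S) l

/-- The sorted telescoping sum vector: the marginal gains obtained when items are added one by
one to the empty set, in the order given by the list, sorted in ascending order. -/
def sortedVector (v : Finset O → ℝ) (order : List O) : List ℝ :=
  Multiset.sort (gainsFrom v ∅ order : Multiset ℝ) (· ≤ ·)

/-- `order` lists the items of the bundle `S`, each exactly once. -/
def IsOrdering (S : Finset O) (order : List O) : Prop :=
  order.Nodup ∧ order.toFinset = S

/-- Order-neutrality: the sorted telescoping sum vector of a bundle does not depend on the
order in which its items are added. -/
def IsOrderNeutral (v : Finset O → ℝ) : Prop :=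
  ∀ (S : Finset O) (p q : List O), IsOrdering S p → IsOrdering S q →
    sortedVector v p = sortedVector v q

/-- `A`-ONSUB functions: order-neutral `A`-SUB functions. -/
def IsONSub (A : Set ℝ) (v : Finset O → ℝ) : Prop :=
  IsSub A v ∧ IsOrderNeutral v

/-- `β^τ(S)`: the number of entries of the sorted telescoping sum vector of `S` that are at
least `τ`. The entries are read off one ordering of `S`; for an order-neutral `v` the choice of
the ordering is immaterial. -/
def beta (τ : ℝ) (v : Finset O → ℝ) (S : Finset O) : ℕ :=
  ((sortedVector v S.toList).filter (fun x => τ ≤ x)).length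

/-! ### Allocations -/

/-- Families `(X_0, X_1, …, X_n)` of bundles. The index `none` stands for `0` (the unallocated
items), the index `some i` for the agent `i`. -/
abbrev Bundles (n : ℕ) (O : Type*) := Option (Fin n) → Finset O

/-- The bundles partition the set of items (bundles may be empty). -/
def IsAllocation (X : Bundles n O) : Prop :=
  ∀ o : O, ∃! k : Option (Fin n), o ∈ X k

/-- Complete allocations: no item is left unallocated. -/
def IsCompleteAllocation (X : Bundles n O) : Prop :=
  IsAllocation X ∧ X none = ∅

/-- Utilitarian social welfare. -/
def usw (v : Fin n → Finset O → ℝ) (X : Bundles n O) : ℝ :=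
  ∑ i : Fin n, v i (X (some i))

/-- `X` is a complete allocation whose utilitarian social welfare is maximum among all complete
allocations. -/
def IsMaxUSW (v : Fin n → Finset O → ℝ) (X : Bundles n O) : Prop :=
  IsCompleteAllocation X ∧ ∀ Y : Bundles n O, IsCompleteAllocation Y → usw v Y ≤ usw v X

/-- The allocation `(O, ∅, …, ∅)`. -/
def emptyAllocation [Fintype O] : Bundles n O
  | none => Finset.univ
  | some _ => ∅

/-- The allocation `X ∪ Y`, in which each agent `i` receives `X_i ∪ Y_i`; an item is unallocated
if it is unallocated in both `X` and `Y`. -/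
def unionAlloc (X Y : Bundles n O) : Bundles n O
  | none => X none ∩ Y none
  | some i => X (some i) ∪ Y (some i)

/-! ### Exchange graphs and path augmentation -/

/-- The edges of the exchange graph `G(X, β)`. -/
def ExchangeEdge (β : Fin n → Finset O → ℕ) (X : Bundles n O) (o o' : O) : Prop :=
  ∃ j : Fin n, o ∈ X (some j) ∧ β j (insert o' ((X (some j)).erase o)) = β j (X (some j))

/-- `F_{β_i}(X, i)`: the items whose marginal gain for agent `i` under `β_i` is `1`. -/
def freeItems (β : Fin n → Finset O → ℕ) (X : Bundles n O) (i : Fin n) : Set O :=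
  {o | β i (insert o (X (some i))) = β i (X (some i)) + 1}

/-- `P` is a path of the exchange graph `G(X, β)` from its first vertex `a ∈ F_{β_i}(X, i)` to
its last vertex `b ∈ X_k`. A path may consist of a single vertex. -/
def IsPath (β : Fin n → Finset O → ℕ) (X : Bundles n O) (i : Fin n) (k : Option (Fin n))
    (P : List O) (a b : O) : Prop :=
  P.head? = some a ∧ P.getLast? = some b ∧ P.Nodup ∧ P.IsChain (ExchangeEdge β X) ∧
    a ∈ freeItems β X i ∧ b ∈ X k

/-- There is a path from `F_{β_i}(X, i)` to `X_k` in the exchange graph `G(X, β)`. -/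
def HasPath (β : Fin n → Finset O → ℕ) (X : Bundles n O) (i : Fin n)
    (k : Option (Fin n)) : Prop :=
  ∃ P a b, IsPath β X i k P a b

/-- The set `{o_j, o_{j+1} : o_j ∈ S}` for a path `P = (o_1, …, o_t)`, where `1 ≤ j < t`. -/
def pathPairs (P : List O) (S : Finset O) : Finset O :=
  (((P.zip P.tail).filter (fun e => e.1 ∈ S)).flatMap (fun e => [e.1, e.2])).toFinset

/-- The family obtained from `X` by augmenting along the path `P` with first vertex `a` and last
vertex `b` and giving `a` to agent `i`: each bundle `X_k` becomes
`(X_k - b) ⊕ {o_j, o_{j+1} : o_j ∈ X_k}`, and agent `i` additionally receives `a`. -/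
def augment (X : Bundles n O) (i : Fin n) (P : List O) (a b : O) : Bundles n O := fun k =>
  if k = some i then insert a (symmDiff ((X k).erase b) (pathPairs P (X k)))
  else symmDiff ((X k).erase b) (pathPairs P (X k))

/-- `P` is a shortest path from `F_{β_i}(X, i)` to `X_k` in `G(X, β)`. -/
def IsShortestPath (β : Fin n → Finset O → ℕ) (X : Bundles n O) (i : Fin n)
    (k : Option (Fin n)) (P : List O) (a b : O) : Prop :=
  IsPath β X i k P a b ∧ ∀ Q a' b', IsPath β X i k Q a' b' → P.length ≤ Q.length

open Classical in
/-- The edge weights of the weighted exchange graph `G^w(Xc, X0, β)`: edges from `Xc_h` to `X0_h`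
for an agent `h` have weight `1/2`, all other edges have weight `1`. -/
def edgeWeight (Xc X0 : Bundles n O) (o o' : O) : ℚ :=
  if ∃ h : Fin n, o ∈ Xc (some h) ∧ o' ∈ X0 (some h) then 1 / 2 else 1

/-- The weight of a path: the sum of the weights of its edges. -/
def pathWeight (Xc X0 : Bundles n O) (P : List O) : ℚ :=
  ((P.zip P.tail).map (fun e => edgeWeight Xc X0 e.1 e.2)).sum

/-- `P` is a minimum weight path from `F_{β_i}(Xc, i)` to `Xc_k` in `G^w(Xc, X0, β)`. -/
def IsMinWeightPath (β : Fin n → Finset O → ℕ) (Xc X0 : Bundles n O) (i : Fin n)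
    (k : Option (Fin n)) (P : List O) (a b : O) : Prop :=
  IsPath β Xc i k P a b ∧
    ∀ Q a' b', IsPath β Xc i k Q a' b' → pathWeight Xc X0 P ≤ pathWeight Xc X0 Q

/-- The rule for breaking ties among minimum weight paths that consist of a single item: such a
path `(o)` with `o ∉ X0_i` may be used only if no item of `X0_i` lies in `F_{β_i}(Xc, i)`. -/
def RespectsTies (β : Fin n → Finset O → ℕ) (Xc X0 : Bundles n O) (i : Fin n)
    (P : List O) : Prop :=
  ∀ o, P = [o] → (∃ o' ∈ X0 (some i), o' ∈ freeItems β Xc i) → o ∈ X0 (some i)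

/-! ### The algorithm -/

/-- The triple of allocations `X^c`, `X^0`, `X^{-1}` that the algorithm maintains. -/
structure Triple (n : ℕ) (O : Type*) where
  /-- the allocation `X^c` -/
  Xc : Bundles n O
  /-- the allocation `X^0` -/
  X0 : Bundles n O
  /-- the allocation `X^{-1}` -/
  Xm : Bundles n O

/-- The allocation `X^c ∪ X^0 ∪ X^{-1}`. -/
def Triple.total (s : Triple n O) : Bundles n O :=
  unionAlloc (unionAlloc s.Xc s.X0) s.Xm

/-- The states of an execution (program point together with the values of the variables). -/
inductive State (n : ℕ) (O : Type*) where
  /-- Phase 1: inside Yankee Swap, with current allocation `X` and set `U` of active agents. -/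
  | yankee (X : Bundles n O) (U : Finset (Fin n))
  /-- Phase 2: at the head of the inner while loop; `changed` records whether a path augmentation
  was done in the current iteration of the outer repeat loop. -/
  | pareto (s : Triple n O) (changed : Bool)
  /-- Phase 2: the inner while loop is finished, the exchange step comes next. -/
  | exchange (s : Triple n O) (changed : Bool)
  /-- Phase 3: at the head of the while loop. -/
  | greedy (s : Triple n O)
  /-- The algorithm has returned the allocation `X`. -/
  | done (X : Bundles n O)

/-- The algorithm considers an exchange path from `F_{β_i}(X, i)` to `X_j`. -/
def ExchangeAllowed (β : Fin n → Finset O → ℕ) (X : Bundles n O) (i j : Fin n) : Prop :=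
  j ≠ i ∧ HasPath β X i (some j) ∧
    ((X (some i)).card + 1 < (X (some j)).card ∨
      ((X (some i)).card + 1 = (X (some j)).card ∧ i < j))

/-- `i` is an agent of `U` with least utility. -/
def IsLeast (β : Fin n → Finset O → ℕ) (X : Bundles n O) (U : Finset (Fin n))
    (i : Fin n) : Prop :=
  i ∈ U ∧ ∀ j ∈ U, β i (X (some i)) ≤ β j (X (some j))

/-- `i` is the agent with the largest index among the agents of maximum utility. -/
def IsGreedyChoice (v : Fin n → Finset O → ℝ) (X : Bundles n O) (i : Fin n) : Prop :=
  (∀ h, v h (X (some h)) ≤ v i (X (some i))) ∧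
    ∀ h, v h (X (some h)) = v i (X (some i)) → h ≤ i

/-- The single steps of the algorithm for the valuations `v` and the positive value `c`. The
relation is nondeterministic: every choice which the algorithm leaves open is allowed. -/
inductive Step [Fintype O] (c : ℝ) (v : Fin n → Finset O → ℝ) : State n O → State n O → Prop
  /-- Yankee Swap with respect to `β^0`: an active agent of least utility augments its bundle
  along a shortest path to the unallocated items. -/
  | yankeeAugment (X : Bundles n O) (U : Finset (Fin n)) (i : Fin n) (P : List O) (a b : O)
      (hi : IsLeast (fun h => beta 0 (v h)) X U i)
      (hP : IsShortestPath (fun h => beta 0 (v h)) X i none P a b) :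
      Step c v (.yankee X U) (.yankee (augment X i P a b) U)
  /-- Yankee Swap: an active agent of least utility without such a path becomes inactive. -/
  | yankeeRemove (X : Bundles n O) (U : Finset (Fin n)) (i : Fin n)
      (hi : IsLeast (fun h => beta 0 (v h)) X U i)
      (hP : ¬ HasPath (fun h => beta 0 (v h)) X i none) :
      Step c v (.yankee X U) (.yankee X (U.erase i))
  /-- Yankee Swap ends; `X^0` is its output, `X^c` and `X^{-1}` are empty. -/
  | yankeeEnd (X : Bundles n O) :
      Step c v (.yankee X ∅) (.pareto ⟨emptyAllocation, X, emptyAllocation⟩ false)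
  /-- Augmentation along a minimum weight Pareto-improving path. -/
  | paretoAugment (s : Triple n O) (changed : Bool) (i : Fin n) (P : List O) (a b : O)
      (hP : IsMinWeightPath (fun h => beta c (v h)) s.Xc s.X0 i none P a b)
      (ht : RespectsTies (fun h => beta c (v h)) s.Xc s.X0 i P) :
      Step c v (.pareto s changed)
        (.pareto
          ⟨augment s.Xc i P a b,
            fun k => if k = none then insert b (s.X0 k) else (s.X0 k).erase b,
            s.Xm⟩ true)
  /-- No Pareto-improving path exists: the inner while loop ends. -/
  | paretoEnd (s : Triple n O) (changed : Bool)
      (hP : ∀ i, ¬ HasPath (fun h => beta c (v h)) s.Xc i none) :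
      Step c v (.pareto s changed) (.exchange s changed)
  /-- Augmentation along a minimum weight exchange path; the outer loop is repeated. -/
  | exchangeAugment (s : Triple n O) (changed : Bool) (i j : Fin n) (P : List O) (a b : O)
      (hij : ExchangeAllowed (fun h => beta c (v h)) s.Xc i j)
      (hP : IsMinWeightPath (fun h => beta c (v h)) s.Xc s.X0 i (some j) P a b) :
      Step c v (.exchange s changed) (.pareto ⟨augment s.Xc i P a b, s.X0, s.Xm⟩ false)
  /-- No exchange, but the current iteration did an augmentation: the outer loop is repeated. -/
  | exchangeNone (s : Triple n O)
      (hij : ∀ i j, ¬ ExchangeAllowed (fun h => beta c (v h)) s.Xc i j) :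
      Step c v (.exchange s true) (.pareto s false)
  /-- No augmentation at all was done in the current iteration: the outer loop ends. -/
  | exchangeEnd (s : Triple n O)
      (hij : ∀ i j, ¬ ExchangeAllowed (fun h => beta c (v h)) s.Xc i j) :
      Step c v (.exchange s false) (.greedy s)
  /-- An arbitrary unallocated item is given to the agent with maximum utility. -/
  | greedyGive (s : Triple n O) (i : Fin n) (o : O)
      (hi : IsGreedyChoice v s.total i) (ho : o ∈ s.total none) :
      Step c v (.greedy s)
        (.greedy ⟨s.Xc, s.X0,
          fun k => if k = some i then insert o (s.Xm k)
            else if k = none then (s.Xm k).erase o else s.Xm k⟩)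
  /-- All items are allocated: the algorithm returns `X^c ∪ X^0 ∪ X^{-1}`. -/
  | greedyEnd (s : Triple n O) (ho : s.total none = ∅) :
      Step c v (.greedy s) (.done s.total)

/-- The initial state: Yankee Swap starts with nothing allocated and all agents active. -/
def start [Fintype O] : State n O :=
  .yankee emptyAllocation Finset.univ

end

end MixedManna

set_option linter.unusedSectionVars false

/-! For order-neutral `v` the marginal of `beta τ v` is the indicator of a `v`-marginal of at least
`τ`, so `beta τ v` is a matroid rank function (`isRank_beta`), and `v = c β^c + β^0 - |S|`
(`valuation_eq`). On complete allocations welfare is therefore `c ∑ β^c + ∑ β^0 - |O|`, and it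
suffices that the output maximizes both total ranks at once (`isMaxUSW_of_isMaxRank`).

Each total rank alone is a matroid union problem. Augmenting along a shortest path keeps all bundles
independent (`augment_card`, from `IsRank.exchange`). If no augmenting path is left, the set of
reachable items certifies optimality (`sum_rank_le`). Yankee Swap thus ends with `∑ β^0` maximum,
because an agent that has lost its paths never regains one (`not_hasPath_augment`).

The crux is that the second phase makes `∑ β^c` maximum without losing `∑ β^0`. Its invariant
`IsDecomposed` says that `X^c` is independent for `β^c` and `X^c ∪ X^0` for `β^0`; moreover the
number of allocated items never drops. Preservation rests on `β^c` being the rank function of a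
quotient of the `β^0`-matroid (`beta_quotient`), which turns spanning for `β^c` into a lower bound
for `β^0` (`IsDecomposed.le_rank`). The weights `1/2` leave minimum weight paths shortest, but make
a path that could end in the `X^0`-bundle of its last owner do so (`IsMinWeightPath.last_edge`). The
item then gained by `X^c_h` is the one lost by `X^0_h`, which pays for the only possible defect in
the bound (`IsDecomposed.pareto`).

The third phase only enlarges bundles, so both ranks stay maximum. Termination follows from a
lexicographic measure. -/

namespace MixedManna

/-! ### Matroid rank functions -/

/-- Matroid rank functions on the finite subsets of `O`. -/
structure IsRank {O : Type*} [DecidableEq O] (r : Finset O → ℕ) : Prop where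
  empty : r ∅ = 0
  le_insert : ∀ S o, r S ≤ r (insert o S)
  insert_le : ∀ S o, r (insert o S) ≤ r S + 1
  submod : ∀ S T o, S ⊆ T → r (insert o T) + r S ≤ r (insert o S) + r T

section Rank

variable {O : Type*} [DecidableEq O] {r : Finset O → ℕ}

theorem IsRank.submod_union (hr : IsRank r) {S T : Finset O} (h : S ⊆ T) (U : Finset O) :
    r (T ∪ U) + r S ≤ r (S ∪ U) + r T := by
  induction U using Finset.induction_on with
  | empty => simp [add_comm]
  | insert x U _ ih =>
    have := hr.submod (S ∪ U) (T ∪ U) x (Finset.union_subset_union_left h)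
    simp only [Finset.union_insert]
    omega

theorem IsRank.mono (hr : IsRank r) {S T : Finset O} (h : S ⊆ T) : r S ≤ r T := by
  have key : ∀ U : Finset O, r S ≤ r (S ∪ U) := by
    intro U
    induction U using Finset.induction_on with
    | empty => simp
    | insert x U _ ih =>
      rw [Finset.union_insert]
      exact ih.trans (hr.le_insert _ _)
  simpa [Finset.union_eq_right.2 h] using key T

theorem IsRank.union_le (hr : IsRank r) (S U : Finset O) : r (S ∪ U) ≤ r S + U.card := by
  induction U using Finset.induction_on with
  | empty => simp
  | insert x U hx ih =>
    rw [Finset.union_insert, Finset.card_insert_of_notMem hx]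
    have := hr.insert_le (S ∪ U) x
    omega

theorem IsRank.le_card (hr : IsRank r) (S : Finset O) : r S ≤ S.card := by
  have := hr.union_le ∅ S
  simpa [hr.empty] using this

/-- Subsets of independent sets are independent. -/
theorem IsRank.indep_subset (hr : IsRank r) {S T : Finset O} (h : S ⊆ T) (hT : r T = T.card) :
    r S = S.card := by
  have h1 := hr.union_le S (T \ S)
  rw [Finset.union_sdiff_of_subset h, Finset.card_sdiff_of_subset h] at h1
  have := Finset.card_le_card h
  have := hr.le_card S
  omega

/-- A set of spanned elements does not increase the rank. -/
theorem IsRank.union_eq (hr : IsRank r) {S U : Finset O} (h : ∀ x ∈ U, r (insert x S) = r S) :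
    r (S ∪ U) = r S := by
  induction U using Finset.induction_on with
  | empty => simp
  | insert x U _ ih =>
    have h1 := ih fun y hy => h y (Finset.mem_insert_of_mem hy)
    have h2 := h x (Finset.mem_insert_self _ _)
    have h3 := hr.submod S (S ∪ U) x Finset.subset_union_left
    have h4 := hr.le_insert (S ∪ U) x
    rw [Finset.union_insert]
    omega

/-- Within an independent set, an element spanned by two subsets is spanned by their
intersection. -/
theorem IsRank.insert_inter (hr : IsRank r) {A B : Finset O} (hAB : r (A ∪ B) = (A ∪ B).card)
    {x : O} (hA : r (insert x A) = r A) (hB : r (insert x B) = r B) :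
    r (insert x (A ∩ B)) = r (A ∩ B) := by
  -- Submodularity for `A + x` and `B + x`; by independence `|A| + |B| = |A ∪ B| + |A ∩ B|`, so `A ∩
  -- B + x` has rank at most `|A ∩ B|`.
  have h1 := hr.submod_union (S := insert x (A ∩ B)) (T := insert x A)
    (Finset.insert_subset_insert _ Finset.inter_subset_left) B
  have e1 : insert x A ∪ B = insert x (A ∪ B) := by simp
  have e2 : insert x (A ∩ B) ∪ B = insert x B := by
    ext y; simp only [Finset.mem_union, Finset.mem_insert, Finset.mem_inter]; tauto
  rw [e1, e2] at h1
  have h2 := hr.le_insert (A ∪ B) x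
  have h3 := hr.indep_subset Finset.subset_union_left hAB
  have h4 := hr.indep_subset Finset.subset_union_right hAB
  have h5 := hr.indep_subset (Finset.inter_subset_left.trans Finset.subset_union_left) hAB
    (S := A ∩ B)
  have h6 := Finset.card_union_add_card_inter A B
  have h7 := hr.le_insert (A ∩ B) x
  omega

/-- The fundamental circuit of `x` in `X` avoids `E`: `X \ E` is the intersection of `X` with the
sets `X - o`, all of which span `x`, so `insert_inter` can be iterated. -/
theorem IsRank.insert_sdiff (hr : IsRank r) {X E : Finset O} (hX : r X = X.card) {x : O}
    (hx : r (insert x X) = r X) (hE : ∀ o ∈ E, r (insert x (X.erase o)) = r (X.erase o)) :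
    r (insert x (X \ E)) = r (X \ E) := by
  induction E using Finset.induction_on with
  | empty => simpa using hx
  | insert o E _ ih =>
    have h1 := ih fun y hy => hE y (Finset.mem_insert_of_mem hy)
    have h2 := hE o (Finset.mem_insert_self _ _)
    have e : X \ insert o E = (X \ E) ∩ X.erase o := by
      ext y; simp only [Finset.mem_sdiff, Finset.mem_insert, Finset.mem_inter,
        Finset.mem_erase]; tauto
    rw [e]
    exact hr.insert_inter (hr.indep_subset
      (Finset.union_subset Finset.sdiff_subset (Finset.erase_subset _ _)) hX) h1 h2

/-- In the exchange graph: a missing edge from `o` to `x` means that `X - o` spans `x`. -/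
theorem IsRank.insert_eq_of_ne (hr : IsRank r) {X : Finset O} (hX : r X = X.card) {o x : O}
    (ho : o ∈ X) (h : r (insert x (X.erase o)) ≠ r X) :
    r (insert x (X.erase o)) = r (X.erase o) := by
  have h1 := hr.indep_subset (Finset.erase_subset o X) hX
  have h2 := Finset.card_erase_add_one ho
  have h3 := hr.insert_le (X.erase o) x
  have h4 := hr.le_insert (X.erase o) x
  omega

/-- `J` lies in the span of `X` and has the same rank, hence the same span, and `y` lies outside of
it. -/
theorem IsRank.insert_spanning (hr : IsRank r) {X B J : Finset O} {y : O}
    (hy : r (insert y X) = r X + 1) (hB : ∀ x ∈ B, r (insert x X) = r X) (hJ : J ⊆ X ∪ B)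
    (hJX : r J = r X) : r (insert y J) = r X + 1 := by
  have h1 := hr.union_eq hB
  have h2 := hr.submod J (X ∪ B) y hJ
  have h3 := hr.mono (Finset.insert_subset_insert y (Finset.subset_union_left (s₁ := X) (s₂ := B)))
  have h4 := hr.insert_le J y
  omega

/-- Simultaneous exchange along pairs without shortcuts keeps an independent set independent. -/
theorem IsRank.exchange (hr : IsRank r) (L : List (O × O)) : ∀ {X : Finset O},
    r X = X.card → (L.map Prod.fst).Nodup → (∀ e ∈ L, e.1 ∈ X) →
    (∀ e ∈ L, r (insert e.2 (X.erase e.1)) = r X) →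
    L.Pairwise (fun e e' => r (insert e'.2 (X.erase e.1)) ≠ r X) →
    r ((X \ (L.map Prod.fst).toFinset) ∪ (L.map Prod.snd).toFinset) = r X := by
  induction L with
  | nil => intro X; simp
  | cons e L ih =>
    obtain ⟨x, y⟩ := e
    intro X hX hnd hmem hedge hpw
    simp only [List.map_cons, List.nodup_cons, List.mem_map, not_exists, not_and] at hnd
    simp only [List.pairwise_cons] at hpw
    simp only [List.mem_cons, forall_eq_or_imp] at hmem hedge
    have hx := hmem.1
    have hcard := Finset.card_erase_add_one hx
    have hX1 := hr.indep_subset (Finset.erase_subset x X) hX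
    have hcl : ∀ e ∈ L, r (insert e.2 (X.erase x)) = r (X.erase x) := fun e he =>
      hr.insert_eq_of_ne hX hx (hpw.1 e he)
    have hne : ∀ e ∈ L, e.1 ≠ x := fun e he => hnd.1 e he
    have hcomm : ∀ z, (X.erase x).erase z = X.erase x ∩ X.erase z := by
      intro z; ext; simp only [Finset.mem_erase, Finset.mem_inter]; tauto
    have hmem1 : ∀ e ∈ L, e.1 ∈ X.erase x := fun e he =>
      Finset.mem_erase.2 ⟨hne e he, hmem.2 e he⟩
    -- All later incoming items lie in the span of `X - x`, so the remaining exchanges are made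
    -- inside `X - x` without changing its span; `y`, which lies outside this span, is added last.
    have IH := ih hX1 hnd.2 hmem1
      (by
        intro e he
        by_contra h
        have h1 := hr.insert_eq_of_ne hX1 (hmem1 e he) h
        have h2 := hr.submod ((X.erase x).erase e.1) (X.erase e.1) e.2
          (Finset.erase_subset_erase _ (Finset.erase_subset _ _))
        have h3 := hedge.2 e he
        have h4 := hr.indep_subset (Finset.erase_subset e.1 X) hX
        have h5 := Finset.card_erase_add_one (hmem.2 e he)
        omega)
      (by
        -- Absent edges stay absent: `e'.2` is spanned by `X - x` and by `X - e.1`, hence by their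
        -- intersection.
        refine hpw.2.imp_of_mem ?_
        intro e e' he he' h hcon
        have h1 := hr.insert_eq_of_ne hX (hmem.2 e he) h
        have h2 := hr.insert_inter (A := X.erase x) (B := X.erase e.1)
          (hr.indep_subset (Finset.union_subset (Finset.erase_subset _ _)
            (Finset.erase_subset _ _)) hX) (hcl e' he') h1
        rw [← hcomm] at h2
        have h3 := hr.indep_subset (Finset.erase_subset e.1 (X.erase x)) hX1
        have h4 := Finset.card_erase_add_one (hmem1 e he)
        omega)
    have h1 := hr.insert_spanning (X := X.erase x) (B := (L.map Prod.snd).toFinset) (y := y)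
      (J := ((X.erase x) \ (L.map Prod.fst).toFinset) ∪ (L.map Prod.snd).toFinset)
      (by have := hedge.1; omega)
      (by
        intro z hz
        simp only [List.mem_toFinset, List.mem_map] at hz
        obtain ⟨e, he, rfl⟩ := hz
        exact hcl e he)
      (Finset.union_subset_union_left Finset.sdiff_subset) IH
    have e1 : (X \ (((x, y) :: L).map Prod.fst).toFinset) ∪ (((x, y) :: L).map Prod.snd).toFinset
        = insert y (((X.erase x) \ (L.map Prod.fst).toFinset) ∪ (L.map Prod.snd).toFinset) := by
      ext z
      simp only [List.map_cons, List.toFinset_cons, Finset.mem_union, Finset.mem_sdiff,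
        Finset.mem_insert, Finset.mem_erase]
      tauto
    rw [e1, h1]
    omega

/-- If `c` is the rank function of a quotient of the matroid with rank function `r`, then
independence with respect to `r` of a union can be tested with `c`. -/
theorem IsRank.quotient_union {c : Finset O → ℕ} (hc : IsRank c)
    (hcr : ∀ S T, S ⊆ T → c T + r S ≤ r T + c S) {A J S : Finset O} (hAJ : A ⊆ J)
    (hJ : c J = J.card) (hAS : r (A ∪ S) = A.card + S.card) :
    J.card + S.card + A.card ≤ r (J ∪ S) + c (A ∪ S) := by
  have h1 := hcr _ _ (Finset.union_subset_union_left (t := S) hAJ)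
  have h2 := hc.mono (Finset.subset_union_left (s₁ := J) (s₂ := S))
  omega

end Rank

/-! ### The functions `β^τ` of order-neutral submodular valuations -/

section Beta

variable {O : Type*} [DecidableEq O] {v : Finset O → ℝ}

theorem gainsFrom_append (v : Finset O → ℝ) (l : List O) (o : O) : ∀ S : Finset O,
    gainsFrom v S (l ++ [o]) = gainsFrom v S l ++ [marginal v (S ∪ l.toFinset) o] := by
  induction l with
  | nil => intro S; simp [gainsFrom]
  | cons x l ih =>
    intro S
    simp only [List.cons_append, gainsFrom, ih, List.toFinset_cons, Finset.insert_union,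
      Finset.union_insert]

theorem length_filter_sortedVector (τ : ℝ) (v : Finset O → ℝ) (l : List O) :
    ((sortedVector v l).filter (fun x => τ ≤ x)).length =
      ((gainsFrom v ∅ l).filter (fun x => τ ≤ x)).length := by
  have : (sortedVector v l).Perm (gainsFrom v ∅ l) := by
    rw [← Multiset.coe_eq_coe]
    exact Multiset.sort_eq _ _
  exact (this.filter _).length_eq

-- Order-neutrality permits `o` to be added last, after the items of `S` in their own order.
open Classical in
theorem beta_insert (hv : IsOrderNeutral v) (τ : ℝ) {S : Finset O} {o : O} (ho : o ∉ S) :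
    beta τ v (insert o S) = beta τ v S + if τ ≤ marginal v S o then 1 else 0 := by
  have h := hv (insert o S) (insert o S).toList (S.toList ++ [o])
    ⟨Finset.nodup_toList _, Finset.toList_toFinset _⟩
    ⟨by simpa [List.nodup_append, Finset.nodup_toList] using ho, by ext; simp⟩
  unfold beta
  rw [h, length_filter_sortedVector, length_filter_sortedVector, gainsFrom_append]
  simp only [Finset.toList_toFinset, Finset.empty_union, List.filter_append, List.length_append,
    List.filter_cons, List.filter_nil]
  split_ifs <;> simp_all

theorem beta_empty (τ : ℝ) (v : Finset O → ℝ) : beta τ v ∅ = 0 := by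
  simp [beta, sortedVector, gainsFrom]

/-- Marginals are `0` or `1` by `beta_insert`, and they decrease because those of `v` do. -/
theorem isRank_beta {A : Set ℝ} (hv : IsONSub A v) (τ : ℝ) : IsRank (beta τ v) where
  empty := beta_empty τ v
  le_insert S o := by
    by_cases ho : o ∈ S
    · rw [Finset.insert_eq_self.2 ho]
    · rw [beta_insert hv.2 τ ho]; omega
  insert_le S o := by
    by_cases ho : o ∈ S
    · rw [Finset.insert_eq_self.2 ho]; omega
    · rw [beta_insert hv.2 τ ho]; split_ifs <;> omega
  submod S T o h := by
    by_cases hT : o ∈ T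
    · rw [Finset.insert_eq_self.2 hT]
      by_cases ho : o ∈ S
      · rw [Finset.insert_eq_self.2 ho]; omega
      · rw [beta_insert hv.2 τ ho]; omega
    · have hS : o ∉ S := fun hS => hT (h hS)
      rw [beta_insert hv.2 τ hT, beta_insert hv.2 τ hS]
      have := hv.1.1.2 S T h o hT
      split_ifs <;> first | omega | (exfalso; linarith)

/-- A gain of at least `τ` is also one of at least `σ`, so `β^σ - β^τ` grows with the set. This is
the quotient relation that couples `X^c` with `X^0`. -/
theorem beta_quotient {A : Set ℝ} (hv : IsONSub A v) {σ τ : ℝ} (h : σ ≤ τ) (S T : Finset O)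
    (hST : S ⊆ T) : beta τ v T + beta σ v S ≤ beta σ v T + beta τ v S := by
  have key : ∀ U : Finset O, beta τ v (S ∪ U) + beta σ v S ≤ beta σ v (S ∪ U) + beta τ v S := by
    intro U
    induction U using Finset.induction_on with
    | empty => simp [add_comm]
    | insert x U _ ih =>
      rw [Finset.union_insert]
      by_cases hx : x ∈ S ∪ U
      · rwa [Finset.insert_eq_self.2 hx]
      · rw [beta_insert hv.2 τ hx, beta_insert hv.2 σ hx]
        split_ifs <;> first | omega | (exfalso; linarith)
  simpa [Finset.union_eq_right.2 hST] using key T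

/-- Gains `-1`, `0`, `c` raise the pair `(β^c, β^0)` by `(0,0)`, `(0,1)`, `(1,1)`, respectively. -/
theorem valuation_eq {c : ℝ} (hc : 0 < c) (hv : IsONSub ({-1, 0, c} : Set ℝ) v) (S : Finset O) :
    v S = c * beta c v S + beta 0 v S - S.card := by
  induction S using Finset.induction_on with
  | empty => simp [beta_empty, hv.1.1.1]
  | insert o S ho ih =>
    have h := hv.1.2 S o ho
    have e : v (insert o S) = v S + marginal v S o := by simp [marginal]
    rw [e, ih, beta_insert hv.2 c ho, beta_insert hv.2 0 ho, Finset.card_insert_of_notMem ho]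
    simp only [Set.mem_insert_iff, Set.mem_singleton_iff] at h
    rcases h with h | h | h <;> rw [h]
    · rw [if_neg (by linarith), if_neg (by norm_num)]; push_cast; ring
    · rw [if_neg (by linarith), if_pos le_rfl]; push_cast; ring
    · rw [if_pos le_rfl, if_pos hc.le]; push_cast; ring

end Beta

/-! ### Paths of the exchange graph -/

section Paths

variable {O : Type*} [DecidableEq O] {n : ℕ} {β : Fin n → Finset O → ℕ} {X : Bundles n O}
  {i : Fin n} {k : Option (Fin n)} {P : List O} {a b : O}

theorem mem_zip_tail_iff {P : List O} {x y : O} :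
    (x, y) ∈ P.zip P.tail ↔ ∃ p, ∃ h : p + 1 < P.length, P[p] = x ∧ P[p + 1] = y := by
  rw [List.mem_iff_getElem]
  simp only [List.getElem_zip, List.getElem_tail, List.length_zip, List.length_tail, Prod.mk.injEq]
  constructor
  · rintro ⟨p, hp, h⟩; exact ⟨p, by omega, h⟩
  · rintro ⟨p, hp, h⟩; exact ⟨p, by omega, h⟩

theorem nodup_map_fst_zip_tail {P : List O} (h : P.Nodup) :
    ((P.zip P.tail).map Prod.fst).Nodup := by
  have : (P.zip P.tail).map Prod.fst = P.take (P.length - 1) := by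
    apply List.ext_getElem
    · simp
    · intro p h1 h2; simp
  rw [this]
  exact h.sublist (List.take_sublist _ _)

theorem nodup_map_snd_zip_tail {P : List O} (h : P.Nodup) :
    ((P.zip P.tail).map Prod.snd).Nodup := by
  rw [List.map_snd_zip (by simp)]
  exact h.sublist (List.tail_sublist _)

theorem IsPath.length_pos (hP : IsPath β X i k P a b) : 0 < P.length := by
  have := hP.1
  cases P <;> simp_all

theorem IsPath.getElem_zero (hP : IsPath β X i k P a b) : P[0]'hP.length_pos = a := by
  have h := hP.1
  rw [List.head?_eq_getElem?, List.getElem?_eq_getElem hP.length_pos] at h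
  exact Option.some.inj h

theorem IsPath.getElem_last (hP : IsPath β X i k P a b) :
    P[P.length - 1]'(by have := hP.length_pos; omega) = b := by
  have h := hP.2.1
  rw [List.getLast?_eq_getElem?,
    List.getElem?_eq_getElem (by have := hP.length_pos; omega)] at h
  exact Option.some.inj h

theorem IsPath.head_mem (hP : IsPath β X i k P a b) : a ∈ P := by
  rw [← hP.getElem_zero]; exact List.getElem_mem _

theorem IsPath.last_mem (hP : IsPath β X i k P a b) : b ∈ P := by
  rw [← hP.getElem_last]; exact List.getElem_mem _

theorem IsPath.edge (hP : IsPath β X i k P a b) {p : ℕ} (h : p + 1 < P.length) :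
    ExchangeEdge β X P[p] P[p + 1] :=
  List.isChain_iff_getElem.1 hP.2.2.2.1 p h

theorem IsPath.edge_of_mem (hP : IsPath β X i k P a b) {x y : O} (h : (x, y) ∈ P.zip P.tail) :
    ExchangeEdge β X x y := by
  obtain ⟨p, hp, rfl, rfl⟩ := mem_zip_tail_iff.1 h
  exact hP.edge hp

theorem IsPath.shortcut (hP : IsPath β X i k P a b) {p q : ℕ} (hpq : p < q) (hq : q < P.length)
    (hE : ExchangeEdge β X P[p] P[q]) : IsPath β X i k (P.take (p + 1) ++ P.drop q) a b := by
  obtain ⟨h1, h2, h3, h4, h5, h6⟩ := hP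
  refine ⟨?_, ?_, ?_, ?_, h5, h6⟩
  · rw [List.head?_append, List.head?_take]; simp [h1]
  · rw [List.getLast?_append, List.getLast?_drop]; simp [h2, hq.not_ge]
  · refine h3.sublist ?_
    conv_rhs => rw [← List.take_append_drop (p + 1) P]
    exact (List.drop_sublist_drop_left _ (by omega)).append_left _
  · refine (h4.take _).append (h4.drop _) ?_
    intro x hx y hy
    rw [List.getLast?_take] at hx
    rw [List.head?_drop, List.getElem?_eq_getElem hq] at hy
    simp only [Nat.add_one_ne_zero, if_false, Nat.add_sub_cancel,
      List.getElem?_eq_getElem (hpq.trans hq), Option.some_or, Option.mem_def,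
      Option.some.injEq] at hx hy
    rw [← hx, ← hy]; exact hE

theorem IsPath.extend (hP : IsPath β X i k P a b) {p : ℕ} (hp : p < P.length) {o : O}
    (hE : ExchangeEdge β X P[p] o) (ho : o ∉ P.take (p + 1)) {k' : Option (Fin n)}
    (hk : o ∈ X k') : IsPath β X i k' (P.take (p + 1) ++ [o]) a o := by
  obtain ⟨h1, h2, h3, h4, h5, h6⟩ := hP
  refine ⟨?_, ?_, ?_, ?_, h5, hk⟩
  · rw [List.head?_append, List.head?_take]; simp [h1]
  · simp
  · rw [List.nodup_append]
    refine ⟨h3.sublist (List.take_sublist _ _), by simp, ?_⟩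
    intro x hx y hy
    rw [List.mem_singleton] at hy
    subst hy
    exact ne_of_mem_of_not_mem hx ho
  · refine (h4.take _).append (by simp) ?_
    intro x hx y hy
    rw [List.getLast?_take] at hx
    simp only [Nat.add_one_ne_zero, if_false, Nat.add_sub_cancel,
      List.getElem?_eq_getElem hp, Option.some_or, Option.mem_def,
      Option.some.injEq, List.head?_cons] at hx hy
    rw [← hx, ← hy]; exact hE

theorem IsPath.take (hP : IsPath β X i k P a b) {p : ℕ} (hp : p < P.length)
    {k' : Option (Fin n)} (hk : P[p] ∈ X k') : IsPath β X i k' (P.take (p + 1)) a P[p] := by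
  obtain ⟨h1, h2, h3, h4, h5, h6⟩ := hP
  refine ⟨?_, ?_, h3.sublist (List.take_sublist _ _), h4.take _, h5, hk⟩
  · rw [List.head?_take]; simp [h1]
  · rw [List.getLast?_take]; simp [List.getElem?_eq_getElem hp]

theorem IsPath.drop (hP : IsPath β X i k P a b) {p : ℕ} (hp : p < P.length)
    {i' : Fin n} (hi : P[p] ∈ freeItems β X i') : IsPath β X i' k (P.drop p) P[p] b := by
  obtain ⟨h1, h2, h3, h4, h5, h6⟩ := hP
  refine ⟨?_, ?_, h3.sublist (List.drop_sublist _ _), h4.drop _, hi, h6⟩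
  · rw [List.head?_drop]; simp [List.getElem?_eq_getElem hp]
  · rw [List.getLast?_drop]; simp [h2, hp.not_ge]

theorem IsShortestPath.not_edge (hP : IsShortestPath β X i k P a b) {p q : ℕ} (hpq : p + 1 < q)
    (hq : q < P.length) : ¬ ExchangeEdge β X P[p] P[q] := by
  intro hE
  have := hP.2 _ _ _ (hP.1.shortcut (by omega) hq hE)
  simp only [List.length_append, List.length_take, List.length_drop] at this
  omega

theorem IsShortestPath.not_free (hP : IsShortestPath β X i k P a b) {p : ℕ} (hp : 0 < p)
    (h : p < P.length) : P[p] ∉ freeItems β X i := by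
  intro hf
  have := hP.2 _ _ _ (hP.1.drop h hf)
  simp only [List.length_drop] at this
  omega

theorem IsShortestPath.not_mem (hP : IsShortestPath β X i k P a b) {p : ℕ}
    (h : p + 1 < P.length) : P[p] ∉ X k := by
  intro hf
  have := hP.2 _ _ _ (hP.1.take (by omega) hf)
  simp only [List.length_take] at this
  omega

end Paths

/-! ### Augmentation along shortest paths -/

section Augment

variable {O : Type*} [DecidableEq O] {n : ℕ} {β : Fin n → Finset O → ℕ} {X : Bundles n O}
  {i : Fin n} {k : Option (Fin n)} {P : List O} {a b : O}

/-- Allocations all of whose bundles are independent. -/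
def IsClean (β : Fin n → Finset O → ℕ) (X : Bundles n O) : Prop :=
  ∀ h, β h (X (some h)) = (X (some h)).card

/-- The edges of the path `P` that start in `S`. -/
def edgesFrom (P : List O) (S : Finset O) : List (O × O) :=
  (P.zip P.tail).filter (fun e => e.1 ∈ S)

/-- The items of `S` with a successor on the path `P`. -/
def outItems (P : List O) (S : Finset O) : Finset O := ((edgesFrom P S).map Prod.fst).toFinset

/-- The successors on the path `P` of the items of `S`. -/
def inItems (P : List O) (S : Finset O) : Finset O := ((edgesFrom P S).map Prod.snd).toFinset

theorem mem_outItems {S : Finset O} {o : O} :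
    o ∈ outItems P S ↔ o ∈ S ∧ ∃ y, (o, y) ∈ P.zip P.tail := by
  simp [outItems, edgesFrom, and_comm]

theorem mem_inItems {S : Finset O} {o : O} :
    o ∈ inItems P S ↔ ∃ x ∈ S, (x, o) ∈ P.zip P.tail := by
  simp [inItems, edgesFrom, and_comm]

theorem mem_pathPairs {S : Finset O} {o : O} :
    o ∈ pathPairs P S ↔ o ∈ outItems P S ∨ o ∈ inItems P S := by
  simp only [pathPairs, List.mem_toFinset, List.mem_flatMap, List.mem_filter, decide_eq_true_eq,
    mem_outItems, mem_inItems, List.mem_cons, List.not_mem_nil, or_false, Prod.exists]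
  constructor
  · rintro ⟨x, y, ⟨h, hx⟩, rfl | rfl⟩
    · exact Or.inl ⟨hx, y, h⟩
    · exact Or.inr ⟨x, hx, h⟩
  · rintro (⟨hx, y, h⟩ | ⟨x, hx, h⟩)
    · exact ⟨o, y, ⟨h, hx⟩, Or.inl rfl⟩
    · exact ⟨x, o, ⟨h, hx⟩, Or.inr rfl⟩

theorem IsAllocation.eq (hX : IsAllocation X) {o : O} {k k' : Option (Fin n)} (h : o ∈ X k)
    (h' : o ∈ X k') : k = k' :=
  (hX o).unique h h'

theorem freeItems_not_mem {i : Fin n} {o : O} (ho : o ∈ freeItems β X i) : o ∉ X (some i) := by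
  intro h
  have ho : β i (insert o (X (some i))) = β i (X (some i)) + 1 := ho
  rw [Finset.insert_eq_self.2 h] at ho
  omega

/-- Edges of the exchange graph of a clean allocation leave the bundle. -/
theorem IsClean.edge_not_mem (hβ : ∀ h, IsRank (β h)) (hX : IsAllocation X) (hc : IsClean β X)
    {x y : O} (hE : ExchangeEdge β X x y) (hne : x ≠ y) {k : Option (Fin n)} (hx : x ∈ X k) :
    y ∉ X k := by
  obtain ⟨j, hj, he⟩ := hE
  obtain rfl := hX.eq hx hj
  intro hy
  rw [Finset.insert_eq_self.2 (Finset.mem_erase.2 ⟨hne.symm, hy⟩), hc j,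
    (hβ j).indep_subset (Finset.erase_subset _ _) (hc j)] at he
  have := Finset.card_erase_add_one hj
  omega

theorem IsPath.mem_iff_out_or_last (hP : IsPath β X i k P a b) {o : O} :
    o ∈ P ↔ (∃ y, (o, y) ∈ P.zip P.tail) ∨ o = b := by
  constructor
  · intro h
    obtain ⟨p, hp, rfl⟩ := List.mem_iff_getElem.1 h
    by_cases h' : p + 1 < P.length
    · exact Or.inl ⟨_, mem_zip_tail_iff.2 ⟨p, h', rfl, rfl⟩⟩
    · right
      rw [← hP.getElem_last]
      congr 1
      omega
  · rintro (⟨y, h⟩ | rfl)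
    · obtain ⟨p, hp, rfl, rfl⟩ := mem_zip_tail_iff.1 h
      exact List.getElem_mem _
    · exact hP.last_mem

theorem IsPath.mem_iff_head_or_in (hP : IsPath β X i k P a b) {o : O} :
    o ∈ P ↔ o = a ∨ ∃ x, (x, o) ∈ P.zip P.tail := by
  constructor
  · intro h
    obtain ⟨p, hp, rfl⟩ := List.mem_iff_getElem.1 h
    rcases p with _ | p
    · exact Or.inl hP.getElem_zero
    · exact Or.inr ⟨_, mem_zip_tail_iff.2 ⟨p, hp, rfl, rfl⟩⟩
  · rintro (rfl | ⟨x, h⟩)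
    · exact hP.head_mem
    · obtain ⟨p, hp, rfl, rfl⟩ := mem_zip_tail_iff.1 h
      exact List.getElem_mem _

theorem IsPath.ne_of_mem_zip (hP : IsPath β X i k P a b) {x y : O}
    (h : (x, y) ∈ P.zip P.tail) : x ≠ y ∧ x ≠ b ∧ y ≠ a := by
  obtain ⟨p, hp, rfl, rfl⟩ := mem_zip_tail_iff.1 h
  have e1 := hP.getElem_last
  have e2 := hP.getElem_zero
  refine ⟨?_, ?_, ?_⟩
  · rw [Ne, hP.2.2.1.getElem_inj_iff]; omega
  · rw [← e1, Ne, hP.2.2.1.getElem_inj_iff]; omega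
  · rw [← e2, Ne, hP.2.2.1.getElem_inj_iff]; omega

theorem IsPath.pred_unique (hP : IsPath β X i k P a b) {x x' y : O}
    (h : (x, y) ∈ P.zip P.tail) (h' : (x', y) ∈ P.zip P.tail) : x = x' := by
  obtain ⟨p, hp, rfl, rfl⟩ := mem_zip_tail_iff.1 h
  obtain ⟨q, hq, rfl, e⟩ := mem_zip_tail_iff.1 h'
  rw [hP.2.2.1.getElem_inj_iff] at e
  congr 1
  omega

/-- The effect of an augmentation on a bundle. -/
theorem augment_eq (hβ : ∀ h, IsRank (β h)) (hX : IsAllocation X) (hc : IsClean β X)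
    (hP : IsPath β X i k P a b) (h : Option (Fin n)) :
    augment X i P a b h = if h = some i then insert a ((X h \ P.toFinset) ∪ inItems P (X h))
      else (X h \ P.toFinset) ∪ inItems P (X h) := by
  have key : symmDiff ((X h).erase b) (pathPairs P (X h)) =
      (X h \ P.toFinset) ∪ inItems P (X h) := by
    ext o
    rw [Finset.mem_symmDiff, mem_pathPairs, Finset.mem_union, Finset.mem_sdiff, Finset.mem_erase,
      List.mem_toFinset, hP.mem_iff_out_or_last]
    have h1 : o ∈ inItems P (X h) → o ∉ X h := by
      intro ho
      obtain ⟨x, hx, hxo⟩ := mem_inItems.1 ho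
      exact hc.edge_not_mem hβ hX (hP.edge_of_mem hxo) (hP.ne_of_mem_zip hxo).1 hx
    have h2 : (∃ y, (o, y) ∈ P.zip P.tail) → o ≠ b := by
      rintro ⟨y, hy⟩
      exact (hP.ne_of_mem_zip hy).2.1
    rw [mem_outItems]
    tauto
  unfold augment
  rw [key]

theorem mem_augment (hβ : ∀ h, IsRank (β h)) (hX : IsAllocation X) (hc : IsClean β X)
    (hP : IsPath β X i k P a b) {h : Option (Fin n)} {o : O} :
    o ∈ augment X i P a b h ↔
      (o ∈ X h ∧ o ∉ P) ∨ (h = some i ∧ o = a) ∨ ∃ x ∈ X h, (x, o) ∈ P.zip P.tail := by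
  rw [augment_eq hβ hX hc hP]
  split_ifs with hh
  · simp only [Finset.mem_insert, Finset.mem_union, Finset.mem_sdiff, List.mem_toFinset,
      mem_inItems]
    tauto
  · simp only [Finset.mem_union, Finset.mem_sdiff, List.mem_toFinset, mem_inItems]
    tauto

/-- The head of the path goes to `i`, every other path item to the owner of its unique predecessor,
and the rest stays. -/
theorem isAllocation_augment (hβ : ∀ h, IsRank (β h)) (hX : IsAllocation X) (hc : IsClean β X)
    (hP : IsPath β X i k P a b) : IsAllocation (augment X i P a b) := by
  intro o
  by_cases ho : o ∈ P
  · rcases hP.mem_iff_head_or_in.1 ho with rfl | ⟨x, hx⟩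
    · refine ⟨some i, (mem_augment hβ hX hc hP).2 (Or.inr (Or.inl ⟨rfl, rfl⟩)), ?_⟩
      intro h hh
      rcases (mem_augment hβ hX hc hP).1 hh with h' | h' | ⟨x, _, hx⟩
      · exact absurd ho h'.2
      · exact h'.1
      · exact absurd rfl (hP.ne_of_mem_zip hx).2.2
    · obtain ⟨h, hh, -⟩ := hX x
      refine ⟨h, (mem_augment hβ hX hc hP).2 (Or.inr (Or.inr ⟨x, hh, hx⟩)), ?_⟩
      intro h' hh'
      rcases (mem_augment hβ hX hc hP).1 hh' with h1 | h1 | ⟨x', h1, hx'⟩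
      · exact absurd ho h1.2
      · exact absurd h1.2 (hP.ne_of_mem_zip hx).2.2
      · rw [hP.pred_unique hx' hx] at h1
        exact hX.eq h1 hh
  · obtain ⟨h, hh, -⟩ := hX o
    refine ⟨h, (mem_augment hβ hX hc hP).2 (Or.inl ⟨hh, ho⟩), ?_⟩
    intro h' hh'
    rcases (mem_augment hβ hX hc hP).1 hh' with h1 | h1 | ⟨x', h1, hx'⟩
    · exact hX.eq h1.1 hh
    · exact absurd (h1.2 ▸ hP.head_mem) ho
    · exact absurd (hP.mem_iff_head_or_in.2 (Or.inr ⟨_, hx'⟩)) ho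

theorem IsPath.out_owner (hP : IsPath β X i k P a b) {x y : O} (h : (x, y) ∈ P.zip P.tail) :
    ∃ j : Fin n, x ∈ X (some j) :=
  let ⟨j, hj, _⟩ := hP.edge_of_mem h
  ⟨j, hj⟩

theorem augment_none (hβ : ∀ h, IsRank (β h)) (hX : IsAllocation X) (hc : IsClean β X)
    (hP : IsPath β X i k P a b) : augment X i P a b none = (X none).erase b := by
  ext o
  rw [mem_augment hβ hX hc hP, Finset.mem_erase, hP.mem_iff_out_or_last]
  have h1 : ∀ x ∈ X none, ∀ y, (x, y) ∉ P.zip P.tail := by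
    intro x hx y hy
    obtain ⟨j, hj⟩ := hP.out_owner hy
    cases hX.eq hx hj
  constructor
  · rintro (h | h | ⟨x, hx, h⟩)
    · tauto
    · cases h.1
    · exact absurd h (h1 x hx _)
  · rintro ⟨h, h'⟩
    left
    refine ⟨h', ?_⟩
    rintro (⟨y, hy⟩ | h2)
    · exact h1 o h' y hy
    · exact h h2

theorem edge_iff (hX : IsAllocation X) {h : Fin n} {x y : O} (hx : x ∈ X (some h)) :
    ExchangeEdge β X x y ↔ β h (insert y ((X (some h)).erase x)) = β h (X (some h)) := by
  constructor
  · rintro ⟨j, hj, he⟩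
    obtain rfl : h = j := Option.some.inj (hX.eq hx hj)
    exact he
  · exact fun he => ⟨h, hx, he⟩

theorem mem_edgesFrom {S : Finset O} {e : O × O} :
    e ∈ edgesFrom P S ↔ e ∈ P.zip P.tail ∧ e.1 ∈ S := by
  simp [edgesFrom]

/-- Exchanging the items of a bundle for their successors on a shortest path keeps the rank. -/
theorem rank_exchange (hβ : ∀ h, IsRank (β h)) (hX : IsAllocation X) (hc : IsClean β X)
    (hP : IsShortestPath β X i k P a b) (h : Fin n) :
    β h ((X (some h) \ outItems P (X (some h))) ∪ inItems P (X (some h))) =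
      (X (some h)).card := by
  rw [← hc h]
  apply (hβ h).exchange (edgesFrom P (X (some h))) (hc h)
  · exact (nodup_map_fst_zip_tail hP.1.2.2.1).sublist (List.filter_sublist.map _)
  · intro e he
    exact (mem_edgesFrom.1 he).2
  · rintro ⟨x, y⟩ he
    obtain ⟨h1, h2⟩ := mem_edgesFrom.1 he
    exact (edge_iff hX h2).1 (hP.1.edge_of_mem h1)
  -- In path order, an edge from an earlier source to a later target would be a shortcut.
  · have : (P.zip P.tail).Pairwise (fun e e' => ¬ ExchangeEdge β X e.1 e'.2) := by
      rw [List.pairwise_iff_getElem]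
      intro p q hp hq hpq
      simp only [List.getElem_zip, List.getElem_tail]
      simp only [List.length_zip, List.length_tail] at hq
      exact hP.not_edge (by omega) (by omega)
    refine (this.filter _).imp_of_mem ?_
    intro e e' he he' hne heq
    exact hne ((edge_iff hX (mem_edgesFrom.1 he).2).2 heq)

theorem card_outItems (hP : P.Nodup) (S : Finset O) :
    (outItems P S).card = (edgesFrom P S).length := by
  rw [outItems, edgesFrom, List.toFinset_card_of_nodup
    ((nodup_map_fst_zip_tail hP).sublist (List.filter_sublist.map _)), List.length_map]

theorem card_inItems (hP : P.Nodup) (S : Finset O) :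
    (inItems P S).card = (edgesFrom P S).length := by
  rw [inItems, edgesFrom, List.toFinset_card_of_nodup
    ((nodup_map_snd_zip_tail hP).sublist (List.filter_sublist.map _)), List.length_map]

theorem not_free (hβ : ∀ h, IsRank (β h)) {h : Fin n} {o : O} (ho : o ∉ freeItems β X h) :
    β h (insert o (X (some h))) = β h (X (some h)) := by
  have h1 : ¬ β h (insert o (X (some h))) = β h (X (some h)) + 1 := ho
  have := (hβ h).le_insert (X (some h)) o
  have := (hβ h).insert_le (X (some h)) o
  omega

/-- Augmentation along a shortest path: the new allocation is clean, the agent `i` gains one item,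
the owner of the last item of the path loses one. -/
theorem augment_card (hβ : ∀ h, IsRank (β h)) (hX : IsAllocation X) (hc : IsClean β X)
    (hP : IsShortestPath β X i k P a b) (hk : k ≠ some i) (h : Fin n) :
    β h (augment X i P a b (some h)) = (augment X i P a b (some h)).card ∧
    (augment X i P a b (some h)).card + (if k = some h then 1 else 0) =
      (X (some h)).card + (if h = i then 1 else 0) := by
  have hb : b ∈ X k := hP.1.2.2.2.2.2
  have ha : a ∈ freeItems β X i := hP.1.2.2.2.2.1
  have hin : ∀ x ∈ inItems P (X (some h)), x ∉ X (some h) := by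
    intro o ho
    obtain ⟨x, hx, hxo⟩ := mem_inItems.1 ho
    exact hc.edge_not_mem hβ hX (hP.1.edge_of_mem hxo) (hP.1.ne_of_mem_zip hxo).1 hx
  have hout : outItems P (X (some h)) ⊆ X (some h) := fun x hx => (mem_outItems.1 hx).1
  have hsd : b ∉ X (some h) →
      X (some h) \ P.toFinset = X (some h) \ outItems P (X (some h)) := by
    intro hbX
    ext o
    simp only [Finset.mem_sdiff, List.mem_toFinset, hP.1.mem_iff_out_or_last, mem_outItems]
    have : o = b → o ∉ X (some h) := by rintro rfl; exact hbX
    tauto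
  have hJ := rank_exchange hβ hX hc hP h
  have hJc : ((X (some h) \ outItems P (X (some h))) ∪ inItems P (X (some h))).card =
      (X (some h)).card := by
    rw [Finset.card_union_of_disjoint, Finset.card_sdiff_of_subset hout, card_outItems hP.1.2.2.1,
      card_inItems hP.1.2.2.1]
    · have := Finset.card_le_card hout
      rw [card_outItems hP.1.2.2.1] at this
      omega
    · rw [Finset.disjoint_left]
      intro x hx hx'
      exact hin x hx' (Finset.mem_sdiff.1 hx).1
  rw [augment_eq hβ hX hc hP.1]
  by_cases hh : h = i
  · subst hh
    have hbX : b ∉ X (some h) := fun h' => hk (hX.eq hb h')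
    have haX := freeItems_not_mem ha
    rw [if_pos rfl, if_neg hk, if_pos rfl, hsd hbX, Finset.card_insert_of_notMem, hJc]
    · refine ⟨?_, rfl⟩
      rw [← hc h]
      -- Only the head of a shortest path is free for `i`, so the incoming items lie in the span of
      -- the bundle, and `a` still raises the rank after the exchange.
      refine (hβ h).insert_spanning ha (B := inItems P (X (some h))) ?_
        (Finset.union_subset_union_left Finset.sdiff_subset) (by rw [hJ, hc h])
      intro x hx
      obtain ⟨y, hy, hyx⟩ := mem_inItems.1 hx
      obtain ⟨p, hp, rfl, rfl⟩ := mem_zip_tail_iff.1 hyx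
      exact not_free hβ (hP.not_free (by omega) hp)
    · rw [Finset.mem_union, Finset.mem_sdiff]
      rintro (h1 | h1)
      · exact haX h1.1
      · obtain ⟨x, -, hx⟩ := mem_inItems.1 h1
        exact (hP.1.ne_of_mem_zip hx).2.2 rfl
  · rw [if_neg (fun h' => hh (Option.some.inj h')), if_neg hh]
    by_cases hkh : k = some h
    · subst hkh
      -- A shortest path meets its target bundle only at the end, so this bundle merely loses `b`.
      have hno : ∀ x ∈ X (some h), ∀ y, (x, y) ∉ P.zip P.tail := by
        intro x hx y hxy
        obtain ⟨p, hp, rfl, rfl⟩ := mem_zip_tail_iff.1 hxy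
        exact hP.not_mem hp hx
      have e1 : inItems P (X (some h)) = ∅ := by
        rw [Finset.eq_empty_iff_forall_notMem]
        intro o ho
        obtain ⟨x, hx, hxo⟩ := mem_inItems.1 ho
        exact hno x hx _ hxo
      have e2 : X (some h) \ P.toFinset = (X (some h)).erase b := by
        ext o
        simp only [Finset.mem_sdiff, List.mem_toFinset, hP.1.mem_iff_out_or_last,
          Finset.mem_erase]
        have : o ∈ X (some h) → ¬ ∃ y, (o, y) ∈ P.zip P.tail :=
          fun ho ⟨y, hy⟩ => hno o ho y hy
        tauto
      rw [e1, e2, Finset.union_empty, if_pos rfl]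
      exact ⟨(hβ h).indep_subset (Finset.erase_subset _ _) (hc h),
        by rw [Finset.card_erase_add_one hb, add_zero]⟩
    · have hbX : b ∉ X (some h) := fun h' => hkh (hX.eq hb h')
      rw [hsd hbX, if_neg hkh, hJc, hJ]
      exact ⟨rfl, rfl⟩

theorem isClean_augment (hβ : ∀ h, IsRank (β h)) (hX : IsAllocation X) (hc : IsClean β X)
    (hP : IsShortestPath β X i k P a b) (hk : k ≠ some i) : IsClean β (augment X i P a b) :=
  fun h => (augment_card hβ hX hc hP hk h).1

end Augment

/-! ### Optimality and persistence of the absence of paths -/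

section Reach

variable {O : Type*} [DecidableEq O] {n : ℕ} {β : Fin n → Finset O → ℕ} {X : Bundles n O}
  {i : Fin n} {k : Option (Fin n)} {P : List O} {a b : O}

/-- The items that can be reached from `F_{β_i}(X, i)` in the exchange graph. -/
def reach (β : Fin n → Finset O → ℕ) (X : Bundles n O) (i : Fin n) : Set O :=
  {o | ∃ k P a, IsPath β X i k P a o}

theorem free_mem_reach (hX : IsAllocation X) {o : O} (ho : o ∈ freeItems β X i) :
    o ∈ reach β X i := by
  obtain ⟨k, hk, -⟩ := hX o
  exact ⟨k, [o], o, rfl, rfl, by simp, by simp, ho, hk⟩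

theorem reach_edge (hX : IsAllocation X) {x y : O} (hx : x ∈ reach β X i)
    (hE : ExchangeEdge β X x y) : y ∈ reach β X i := by
  obtain ⟨k, P, a, hP⟩ := hx
  obtain ⟨k', hk', -⟩ := hX y
  by_cases hy : y ∈ P
  · obtain ⟨p, hp, rfl⟩ := List.mem_iff_getElem.1 hy
    exact ⟨k', _, a, hP.take hp hk'⟩
  · refine ⟨k', _, a, hP.extend (p := P.length - 1) (by have := hP.length_pos; omega) ?_
      (fun h => hy (List.mem_of_mem_take h)) hk'⟩
    rw [hP.getElem_last]
    exact hE

theorem reach_not_mem (h : ¬ HasPath β X i k) {o : O} (ho : o ∈ reach β X i) : o ∉ X k := by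
  intro hk
  obtain ⟨k', P, a, h1, h2, h3, h4, h5, -⟩ := ho
  exact h ⟨P, a, o, h1, h2, h3, h4, h5, hk⟩

theorem IsPath.mem_of_closed (hP : IsPath β X i k P a b) {Z : Set O}
    (ha : a ∈ Z) (hZ : ∀ x ∈ Z, ∀ y, ExchangeEdge β X x y → y ∈ Z) : ∀ o ∈ P, o ∈ Z := by
  have key : ∀ p, ∀ hp : p < P.length, P[p] ∈ Z := by
    intro p
    induction p with
    | zero => intro _; rw [hP.getElem_zero]; exact ha
    | succ p ih => intro hp; exact hZ _ (ih (by omega)) _ (hP.edge hp)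
  intro o ho
  obtain ⟨p, hp, rfl⟩ := List.mem_iff_getElem.1 ho
  exact key p hp

/-- Items outside of a closed set that meets the bundle are spanned by the part of the bundle
outside of the closed set. -/
theorem span_of_closed (hβ : ∀ h, IsRank (β h)) (hX : IsAllocation X) (hc : IsClean β X)
    {Z : Finset O} (hZ : ∀ x ∈ Z, ∀ y, ExchangeEdge β X x y → y ∈ Z) {h : Fin n}
    (hh : (X (some h) ∩ Z).Nonempty ∨ ∀ o ∈ freeItems β X h, o ∈ Z) {o : O} (ho : o ∉ Z) :
    β h (insert o (X (some h) \ Z)) = β h (X (some h) \ Z) := by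
  have h1 : ∀ z ∈ X (some h) ∩ Z,
      β h (insert o ((X (some h)).erase z)) = β h ((X (some h)).erase z) := by
    intro z hz
    obtain ⟨hzX, hzZ⟩ := Finset.mem_inter.1 hz
    exact (hβ h).insert_eq_of_ne (hc h) hzX
      fun he => ho (hZ z hzZ o ((edge_iff hX hzX).2 he))
  have h2 : β h (insert o (X (some h))) = β h (X (some h)) := by
    rcases hh with ⟨z, hz⟩ | hh
    · have h3 := h1 z hz
      have h4 := (hβ h).submod _ _ o (Finset.erase_subset z (X (some h)))
      have h5 := (hβ h).le_insert (X (some h)) o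
      omega
    · exact not_free hβ fun h' => ho (hh o h')
  have := (hβ h).insert_sdiff (hc h) h2 h1
  rwa [Finset.sdiff_inter_self_left] at this

theorem sum_card_inter {Y : Bundles n O} (hY : IsAllocation Y) (Z : Finset O) :
    ∑ h, (Y (some h) ∩ Z).card + (Y none ∩ Z).card = Z.card := by
  have : Z = Finset.univ.biUnion fun k : Option (Fin n) => Y k ∩ Z := by
    ext o
    simp only [Finset.mem_biUnion, Finset.mem_univ, true_and, Finset.mem_inter]
    constructor
    · intro h
      obtain ⟨k, hk, -⟩ := hY o
      exact ⟨k, hk, h⟩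
    · rintro ⟨k, -, h⟩; exact h
  conv_rhs => rw [this]
  rw [Finset.card_biUnion, Fintype.sum_option, add_comm]
  intro k _ k' _ hkk
  refine Finset.disjoint_left.2 fun o ho ho' => ?_
  exact hkk (hY.eq (Finset.mem_inter.1 ho).1 (Finset.mem_inter.1 ho').1)

variable [Fintype O]

/-- The independent set `X_h \ Z` spans the whole complement of `Z`. This is the tightness needed in
the min-max argument. -/
theorem rank_compl_of_closed (hβ : ∀ h, IsRank (β h)) (hX : IsAllocation X) (hc : IsClean β X)
    {Z : Finset O} (hZ : ∀ x ∈ Z, ∀ y, ExchangeEdge β X x y → y ∈ Z) {h : Fin n}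
    (hh : (X (some h) ∩ Z).Nonempty ∨ ∀ o ∈ freeItems β X h, o ∈ Z) :
    β h Zᶜ = (X (some h) \ Z).card := by
  have h1 := (hβ h).union_eq (S := X (some h) \ Z) (U := Zᶜ) fun x hx =>
    span_of_closed hβ hX hc hZ hh (Finset.mem_compl.1 hx)
  have h2 : X (some h) \ Z ∪ Zᶜ = Zᶜ := by
    rw [Finset.union_eq_right]
    intro x hx
    exact Finset.mem_compl.2 (Finset.mem_sdiff.1 hx).2
  rw [h2] at h1
  rw [h1, (hβ h).indep_subset Finset.sdiff_subset (hc h)]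

/-- A clean allocation without Pareto-improving paths has maximum total rank. -/
theorem sum_rank_le (hβ : ∀ h, IsRank (β h)) (hX : IsAllocation X) (hc : IsClean β X)
    (hno : ∀ i, ¬ HasPath β X i none) {Y : Bundles n O} (hY : IsAllocation Y) :
    ∑ h, β h (Y (some h)) ≤ ∑ h, (X (some h)).card := by
  classical
  -- Every allocation satisfies `∑ β(Y_h) ≤ ∑ β_h(Zᶜ) + |Z|`; for the set `Z` of reachable items `X`
  -- attains this bound, since `Z` contains no unallocated item.
  set Z : Finset O := Finset.univ.filter fun o => ∃ i, o ∈ reach β X i with hZdef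
  have memZ : ∀ o, o ∈ Z ↔ ∃ i, o ∈ reach β X i := by simp [hZdef]
  have hZ : ∀ x ∈ Z, ∀ y, ExchangeEdge β X x y → y ∈ Z := by
    intro x hx y hE
    obtain ⟨i, hi⟩ := (memZ x).1 hx
    exact (memZ y).2 ⟨i, reach_edge hX hi hE⟩
  have hrank : ∀ h, β h Zᶜ = (X (some h) \ Z).card := fun h =>
    rank_compl_of_closed hβ hX hc hZ (Or.inr fun o ho => (memZ o).2 ⟨h, free_mem_reach hX ho⟩)
  have hXZ : X none ∩ Z = ∅ := by
    rw [Finset.eq_empty_iff_forall_notMem]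
    intro o ho
    obtain ⟨h1, h2⟩ := Finset.mem_inter.1 ho
    obtain ⟨i, hi⟩ := (memZ o).1 h2
    exact reach_not_mem (hno i) hi h1
  have h1 : ∀ h, β h (Y (some h)) ≤ β h Zᶜ + (Y (some h) ∩ Z).card := by
    intro h
    refine ((hβ h).mono ?_).trans ((hβ h).union_le Zᶜ (Y (some h) ∩ Z))
    intro o ho
    simp only [Finset.mem_union, Finset.mem_compl, Finset.mem_inter]
    tauto
  have h2 := sum_card_inter hY Z
  have h3 := sum_card_inter hX Z
  rw [hXZ, Finset.card_empty, add_zero] at h3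
  calc ∑ h, β h (Y (some h)) ≤ ∑ h, (β h Zᶜ + (Y (some h) ∩ Z).card) :=
        Finset.sum_le_sum fun h _ => h1 h
    _ = ∑ h, (X (some h) \ Z).card + ∑ h, (Y (some h) ∩ Z).card := by
        rw [Finset.sum_add_distrib]; simp only [hrank]
    _ ≤ ∑ h, (X (some h) \ Z).card + ∑ h, (X (some h) ∩ Z).card := by omega
    _ = ∑ h, (X (some h)).card := by
        rw [← Finset.sum_add_distrib]
        exact Finset.sum_congr rfl fun h _ => Finset.card_sdiff_add_card_inter _ _

/-- An agent without a path to the unallocated items does not get one by an augmentation along a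
shortest path for some agent. -/
theorem not_hasPath_augment (hβ : ∀ h, IsRank (β h)) (hX : IsAllocation X) (hc : IsClean β X)
    (hP : IsShortestPath β X i none P a b) {j : Fin n} (hj : ¬ HasPath β X j none) :
    ¬ HasPath β (augment X i P a b) j none := by
  classical
  set Z : Finset O := Finset.univ.filter fun o => o ∈ reach β X j with hZdef
  have memZ : ∀ o, o ∈ Z ↔ o ∈ reach β X j := by simp [hZdef]
  have hZ : ∀ x ∈ Z, ∀ y, ExchangeEdge β X x y → y ∈ Z := by
    intro x hx y hE
    exact (memZ y).2 (reach_edge hX ((memZ x).1 hx) hE)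
  -- If `P` met the items reachable from `j`, its unallocated end would be reachable from `j`.
  have hPZ : ∀ o ∈ P, o ∉ Z := by
    intro o ho hoZ
    obtain ⟨p, hp, rfl⟩ := List.mem_iff_getElem.1 ho
    have key : ∀ d, ∀ hd : p + d < P.length, P[p + d] ∈ Z := by
      intro d
      induction d with
      | zero => intro _; exact hoZ
      | succ d ih => intro hd; exact hZ _ (ih (by omega)) _ (hP.1.edge (p := p + d) hd)
    have h1 := key (P.length - 1 - p) (by omega)
    have h2 : P[p + (P.length - 1 - p)]'(by omega) = b := by
      rw [← hP.1.getElem_last]; congr 1; omega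
    rw [h2] at h1
    exact reach_not_mem hj ((memZ b).1 h1) hP.1.2.2.2.2.2
  have hX' := isAllocation_augment hβ hX hc hP.1
  have hc' := isClean_augment hβ hX hc hP (by simp)
  set X' := augment X i P a b with hX'def
  have hint : ∀ h, X' (some h) ∩ Z = X (some h) ∩ Z := by
    intro h
    ext o
    simp only [Finset.mem_inter, hX'def, mem_augment hβ hX hc hP.1]
    constructor
    · rintro ⟨h1 | h1 | ⟨x, -, hx⟩, h2⟩
      · exact ⟨h1.1, h2⟩
      · exact absurd h2 (hPZ _ (h1.2 ▸ hP.1.head_mem))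
      · exact absurd h2 (hPZ _ (hP.1.mem_iff_head_or_in.2 (Or.inr ⟨x, hx⟩)))
    · rintro ⟨h1, h2⟩
      exact ⟨Or.inl ⟨h1, fun h' => hPZ o h' h2⟩, h2⟩
  -- No bundle shrinks and the parts in `Z` are unchanged, so `X'_h \ Z` still attains the rank of
  -- `Zᶜ`. Hence `Z` stays closed and still contains all free items of `j`.
  have hspan : ∀ h, (X (some h) ∩ Z).Nonempty ∨ h = j → ∀ o, o ∉ Z →
      β h (insert o (X' (some h) \ Z)) = β h (X' (some h) \ Z) := by
    intro h hh o ho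
    have h1 : β h Zᶜ = (X (some h) \ Z).card := by
      refine rank_compl_of_closed hβ hX hc hZ (hh.imp id ?_)
      rintro rfl o ho
      exact (memZ o).2 (free_mem_reach hX ho)
    have h2 := (augment_card hβ hX hc hP (by simp) h).2
    have h3 := Finset.card_sdiff_add_card_inter (X' (some h)) Z
    have h4 := Finset.card_sdiff_add_card_inter (X (some h)) Z
    rw [hint] at h3
    have h5 : β h (X' (some h) \ Z) = (X' (some h) \ Z).card :=
      (hβ h).indep_subset Finset.sdiff_subset (hc' h)
    have h6 : β h (insert o (X' (some h) \ Z)) ≤ β h Zᶜ := by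
      apply (hβ h).mono
      intro x hx
      rw [Finset.mem_compl]
      rcases Finset.mem_insert.1 hx with rfl | hx
      · exact ho
      · exact (Finset.mem_sdiff.1 hx).2
    have h7 := (hβ h).le_insert (X' (some h) \ Z) o
    rw [← hX'def] at h2
    simp only [reduceCtorEq, if_false] at h2
    omega
  rintro ⟨Q, a', b', hQ⟩
  have hall := hQ.mem_of_closed (Z := (Z : Set O))
    (by
      by_contra h
      have h1 := hspan j (Or.inr rfl) a' h
      have h2 := (hβ j).submod _ _ a' (Finset.sdiff_subset (s := X' (some j)) (t := Z))
      have h3 : β j (insert a' (X' (some j))) = β j (X' (some j)) + 1 := hQ.2.2.2.2.1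
      omega)
    (by
      intro x hx y hE
      by_contra hy
      obtain ⟨h, hxh, he⟩ := hE
      have hne : (X (some h) ∩ Z).Nonempty := ⟨x, hint h ▸ Finset.mem_inter.2 ⟨hxh, hx⟩⟩
      have h1 := hspan h (Or.inl hne) y hy
      have h2 := (hβ h).submod (X' (some h) \ Z) ((X' (some h)).erase x) y (by
        intro z hz
        rw [Finset.mem_sdiff] at hz
        exact Finset.mem_erase.2 ⟨fun e => hz.2 (e ▸ hx), hz.1⟩)
      have h3 := (hβ h).indep_subset (Finset.erase_subset x (X' (some h))) (hc' h)
      have h4 := Finset.card_erase_add_one hxh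
      have h5 := hc' h
      omega)
  refine reach_not_mem hj ((memZ b').1 (hall b' hQ.last_mem)) ?_
  have := hQ.2.2.2.2.2
  rw [hX'def, augment_none hβ hX hc hP.1] at this
  exact Finset.mem_of_mem_erase this

end Reach

/-! ### Minimum weight paths -/

section Weight

variable {O : Type*} [DecidableEq O] {n : ℕ} {β : Fin n → Finset O → ℕ} {Xc X0 : Bundles n O}
  {i : Fin n} {k : Option (Fin n)} {P : List O} {a b : O}

theorem pathWeight_singleton (x : O) : pathWeight Xc X0 [x] = 0 := by simp [pathWeight]

theorem pathWeight_cons (x y : O) (l : List O) :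
    pathWeight Xc X0 (x :: y :: l) = edgeWeight Xc X0 x y + pathWeight Xc X0 (y :: l) := by
  simp [pathWeight]

theorem pathWeight_append (x y : O) (l : List O) :
    pathWeight Xc X0 (l ++ [x] ++ [y]) = pathWeight Xc X0 (l ++ [x]) + edgeWeight Xc X0 x y := by
  induction l with
  | nil => simp [pathWeight]
  | cons z l ih =>
    cases l with
    | nil => simp [pathWeight]
    | cons w l =>
      simp only [List.cons_append] at ih ⊢
      rw [pathWeight_cons, pathWeight_cons, ih, add_assoc]

theorem edgeWeight_le (x y : O) : edgeWeight Xc X0 x y ≤ 1 := by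
  unfold edgeWeight; split_ifs <;> norm_num

theorem le_edgeWeight (x y : O) : 1 / 2 ≤ edgeWeight Xc X0 x y := by
  unfold edgeWeight; split_ifs <;> norm_num

theorem edgeWeight_eq_one (hd : ∀ h, ∀ o ∈ X0 (some h), o ∈ Xc none) {x y : O}
    (hy : y ∉ Xc none) : edgeWeight Xc X0 x y = 1 := by
  unfold edgeWeight
  rw [if_neg]
  rintro ⟨h, -, h'⟩
  exact hy (hd h y h')

theorem pathWeight_le (l : List O) : ∀ x, pathWeight Xc X0 (x :: l) ≤ l.length := by
  induction l with
  | nil => intro x; simp [pathWeight]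
  | cons y l ih =>
    intro x
    rw [pathWeight_cons, List.length_cons]
    have := ih y
    have := edgeWeight_le (Xc := Xc) (X0 := X0) x y
    push_cast
    linarith

/-- Edges of weight `1/2` enter `X^c_0`, whose items have no outgoing edges; so only the last edge
can be cheap. -/
theorem le_pathWeight (hX : IsAllocation Xc) (hd : ∀ h, ∀ o ∈ X0 (some h), o ∈ Xc none)
    (l : List O) : ∀ x, (x :: l).IsChain (ExchangeEdge β Xc) →
    (l.length : ℚ) - 1 / 2 ≤ pathWeight Xc X0 (x :: l) := by
  induction l with
  | nil => intro x _; simp [pathWeight]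
  | cons y l ih =>
    intro x hch
    cases l with
    | nil =>
      rw [pathWeight_cons, pathWeight_singleton]
      have := le_edgeWeight (Xc := Xc) (X0 := X0) x y
      simp only [List.length_cons, List.length_nil]
      push_cast
      linarith
    | cons z l =>
      rw [List.isChain_cons_cons] at hch
      have h1 := ih y hch.2
      obtain ⟨j, hj, -⟩ := (List.isChain_cons_cons.1 hch.2).1
      rw [pathWeight_cons, edgeWeight_eq_one hd (fun hy => by cases hX.eq hy hj)]
      simp only [List.length_cons] at h1 ⊢
      push_cast at h1 ⊢
      linarith

theorem pathWeight_eq (hd : ∀ h, ∀ o ∈ X0 (some h), o ∈ Xc none)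
    (l : List O) : ∀ x, (∀ y ∈ l, y ∉ Xc none) → pathWeight Xc X0 (x :: l) = l.length := by
  induction l with
  | nil => intro x _; simp [pathWeight]
  | cons y l ih =>
    intro x hl
    rw [pathWeight_cons, ih y (fun z hz => hl z (List.mem_cons_of_mem _ hz)),
      edgeWeight_eq_one hd (hl y List.mem_cons_self), List.length_cons]
    push_cast
    ring

/-- The weight differs from the number of edges by at most `1/2`, so the weights only break ties
among shortest paths. -/
theorem IsMinWeightPath.isShortest_none (hX : IsAllocation Xc)
    (hd : ∀ h, ∀ o ∈ X0 (some h), o ∈ Xc none)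
    (hP : IsMinWeightPath β Xc X0 i none P a b) : IsShortestPath β Xc i none P a b := by
  refine ⟨hP.1, fun Q a' b' hQ => ?_⟩
  have h1 := hP.2 Q a' b' hQ
  have hPc := hP.1.2.2.2.1
  have hP0 := hP.1.length_pos
  have hQ0 := hQ.length_pos
  rcases P with _ | ⟨x, P⟩
  · simp at hP0
  rcases Q with _ | ⟨y, Q⟩
  · simp at hQ0
  have h2 := le_pathWeight hX hd P x hPc
  have h3 := pathWeight_le (Xc := Xc) (X0 := X0) Q y
  have h4 : (P.length : ℚ) < (Q.length + 1 : ℕ) := by push_cast; linarith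
  have h5 := Nat.cast_lt.1 h4
  simp only [List.length_cons]
  omega

theorem IsPath.not_mem_none (hX : IsAllocation Xc) {j : Fin n}
    (hP : IsPath β Xc i (some j) P a b) : ∀ o ∈ P, o ∉ Xc none := by
  intro o ho h
  rcases hP.mem_iff_out_or_last.1 ho with ⟨y, hy⟩ | rfl
  · obtain ⟨j, hj⟩ := hP.out_owner hy
    cases hX.eq h hj
  · cases hX.eq h hP.2.2.2.2.2

theorem IsMinWeightPath.isShortest_some (hX : IsAllocation Xc)
    (hd : ∀ h, ∀ o ∈ X0 (some h), o ∈ Xc none) {j : Fin n}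
    (hP : IsMinWeightPath β Xc X0 i (some j) P a b) : IsShortestPath β Xc i (some j) P a b := by
  refine ⟨hP.1, fun Q a' b' hQ => ?_⟩
  have h1 := hP.2 Q a' b' hQ
  have hP0 := hP.1.length_pos
  have hQ0 := hQ.length_pos
  have hP1 := hP.1.not_mem_none hX
  have hQ1 := hQ.not_mem_none hX
  rcases P with _ | ⟨x, P⟩
  · simp at hP0
  rcases Q with _ | ⟨y, Q⟩
  · simp at hQ0
  rw [pathWeight_eq hd P x fun y hy => hP1 y (List.mem_cons_of_mem _ hy),
    pathWeight_eq hd Q y fun y hy => hQ1 y (List.mem_cons_of_mem _ hy), Nat.cast_le] at h1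
  simpa using h1

/-- If an item on a minimum weight path to the unallocated items has an edge to an item of its
owner's bundle in `X0`, then it is the last but one and the path ends in that bundle. -/
theorem IsMinWeightPath.last_edge (hX : IsAllocation Xc)
    (hd : ∀ h, ∀ o ∈ X0 (some h), o ∈ Xc none)
    (hP : IsMinWeightPath β Xc X0 i none P a b) {h : Fin n} {x s : O} (hx : x ∈ P)
    (hxh : x ∈ Xc (some h)) (hs : s ∈ X0 (some h)) (hE : ExchangeEdge β Xc x s) :
    (x, b) ∈ P.zip P.tail ∧ b ∈ X0 (some h) := by
  obtain ⟨p, hp, rfl⟩ := List.mem_iff_getElem.1 hx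
  have hsn := hd h s hs
  have hmem : ∀ q, ∀ hq : q < P.length, q ≤ p → P[q] ∉ Xc none := by
    intro q hq hqp hn
    rcases hqp.eq_or_lt with rfl | hqp
    · cases hX.eq hn hxh
    · obtain ⟨j, hj⟩ := hP.1.out_owner (mem_zip_tail_iff.2 ⟨q, by omega, rfl, rfl⟩)
      cases hX.eq hn hj
  have hst : s ∉ P.take (p + 1) := by
    intro hst
    obtain ⟨q, hq, rfl⟩ := List.mem_iff_getElem.1 hst
    rw [List.length_take] at hq
    rw [List.getElem_take] at hsn
    exact hmem q (by omega) (by omega) hsn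
  -- The competitor leaves `P` at `x` and ends in `s`. Its length forces `x` to be last but one; its
  -- weight then forces the last edge of `P` to be cheap too.
  have hQ := hP.1.extend hp hE hst hsn
  have h1 := (hP.isShortest_none hX hd).2 _ _ _ hQ
  simp only [List.length_append, List.length_take, List.length_singleton] at h1
  have hb := hP.1.getElem_last
  have hp1 : p + 1 < P.length := by
    by_contra hcon
    have : P[p] = b := by rw [← hb]; congr 1; omega
    rw [this] at hxh
    cases hX.eq hxh hP.1.2.2.2.2.2
  have hpb : P[p + 1] = b := by rw [← hb]; congr 1; omega
  refine ⟨mem_zip_tail_iff.2 ⟨p, hp1, rfl, hpb⟩, ?_⟩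
  by_contra hbh
  have h2 := hP.2 _ _ _ hQ
  have e1 : P.take (p + 1) = P.take p ++ [P[p]] := by
    rw [List.take_add_one, List.getElem?_eq_getElem hp]; rfl
  have e2 : P = P.take p ++ [P[p]] ++ [b] := by
    rw [← e1]
    conv_lhs => rw [← List.take_append_drop (p + 1) P]
    rw [List.drop_eq_getElem_cons hp1, hpb, List.drop_eq_nil_of_le (by omega)]
  have h3 : pathWeight Xc X0 P =
      pathWeight Xc X0 (P.take p ++ [P[p]]) + edgeWeight Xc X0 P[p] b := by
    conv_lhs => rw [e2]
    rw [pathWeight_append]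
  rw [h3, e1, pathWeight_append] at h2
  have h4 : edgeWeight Xc X0 P[p] b = 1 := by
    unfold edgeWeight
    rw [if_neg]
    rintro ⟨h', h5, h6⟩
    obtain rfl := Option.some.inj (hX.eq hxh h5)
    exact hbh h6
  have h5 : edgeWeight Xc X0 P[p] s = 1 / 2 := by
    unfold edgeWeight
    rw [if_pos ⟨h, hxh, hs⟩]
  rw [h4, h5] at h2
  linarith

end Weight

/-! ### The second phase -/

section PhaseTwo

variable {O : Type*} [DecidableEq O] {n : ℕ} {βc β0 : Fin n → Finset O → ℕ}
  {Xc X0 : Bundles n O} {i : Fin n} {k : Option (Fin n)} {P : List O} {a b : O}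

/-- The allocations `X^c` and `X^0` of the second phase: `X^c` is clean for `β^c`, the union of
both is clean for `β^0`, and they allocate disjoint sets of items. -/
structure IsDecomposed (βc β0 : Fin n → Finset O → ℕ) (Xc X0 : Bundles n O) : Prop where
  allocC : IsAllocation Xc
  cleanC : IsClean βc Xc
  alloc0 : IsAllocation X0
  disj : ∀ h, ∀ o ∈ X0 (some h), o ∈ Xc none
  indep : ∀ h, β0 h (Xc (some h) ∪ X0 (some h)) = (Xc (some h) ∪ X0 (some h)).card

theorem IsDecomposed.disjoint (hD : IsDecomposed βc β0 Xc X0) (h : Fin n) :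
    Disjoint (Xc (some h)) (X0 (some h)) := by
  rw [Finset.disjoint_left]
  intro o h1 h2
  cases hD.allocC.eq h1 (hD.disj h o h2)

theorem mem_augment_of_notMem (hβc : ∀ h, IsRank (βc h)) (hX : IsAllocation Xc)
    (hc : IsClean βc Xc) (hP : IsPath βc Xc i k P a b) (h : Option (Fin n)) :
    Xc h \ P.toFinset ⊆ augment Xc i P a b h := by
  intro o ho
  rw [Finset.mem_sdiff, List.mem_toFinset] at ho
  exact (mem_augment hβc hX hc hP).2 (Or.inl ho)

/-- A lower bound for the rank of a bundle of an augmented allocation together with `X^0`. -/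
theorem IsDecomposed.le_rank (hβc : ∀ h, IsRank (βc h)) (hβ0 : ∀ h, IsRank (β0 h))
    (hq : ∀ h S T, S ⊆ T → βc h T + β0 h S ≤ β0 h T + βc h S)
    (hD : IsDecomposed βc β0 Xc X0) (hP : IsShortestPath βc Xc i k P a b) (hk : k ≠ some i)
    {h : Fin n} (hspan : ∀ s ∈ X0 (some h), s ∉ freeItems βc Xc h) {E : Finset O}
    (hE : ∀ o ∈ E, o ∈ Xc (some h) ∧ ∀ s ∈ X0 (some h), ¬ ExchangeEdge βc Xc o s) :
    (augment Xc i P a b (some h)).card + (X0 (some h)).card + (Xc (some h) \ P.toFinset).card ≤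
      β0 h (augment Xc i P a b (some h) ∪ X0 (some h)) + (Xc (some h) \ (E ∩ P.toFinset)).card := by
  set A := Xc (some h) \ P.toFinset
  have hAS : β0 h (A ∪ X0 (some h)) = A.card + (X0 (some h)).card := by
    rw [(hβ0 h).indep_subset (Finset.union_subset_union_left Finset.sdiff_subset) (hD.indep h),
      Finset.card_union_of_disjoint ((hD.disjoint h).mono_left Finset.sdiff_subset)]
  -- `A`, the part of the bundle off the path, survives in the new bundle and is `β^0`-independent
  -- together with `X^0_h`. It remains to bound `β^c (A ∪ X^0_h)`.
  have h1 := (hβc h).quotient_union (hq h) (A := A)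
    (mem_augment_of_notMem hβc hD.allocC hD.cleanC hP.1 (some h))
    (augment_card hβc hD.allocC hD.cleanC hP hk h).1 hAS
  -- Items without edges into `X^0_h` lie on no fundamental circuit of an item of `X^0_h`, so
  -- `X^0_h` remains spanned after they are deleted.
  have h2 : βc h (Xc (some h) \ (E ∩ P.toFinset) ∪ X0 (some h)) =
      (Xc (some h) \ (E ∩ P.toFinset)).card := by
    rw [(hβc h).union_eq, (hβc h).indep_subset Finset.sdiff_subset (hD.cleanC h)]
    intro s hs
    refine (hβc h).insert_sdiff (hD.cleanC h) (not_free hβc (hspan s hs)) ?_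
    intro o ho
    obtain ⟨ho1, ho2⟩ := hE o (Finset.mem_inter.1 ho).1
    exact (hβc h).insert_eq_of_ne (hD.cleanC h) ho1
      fun he => ho2 s hs ((edge_iff hD.allocC ho1).2 he)
  have h3 : βc h (A ∪ X0 (some h)) ≤ βc h (Xc (some h) \ (E ∩ P.toFinset) ∪ X0 (some h)) :=
    (hβc h).mono (Finset.union_subset_union_left
      (Finset.sdiff_subset_sdiff subset_rfl Finset.inter_subset_right))
  omega

theorem hasPath_of_free {β : Fin n → Finset O → ℕ} {X : Bundles n O} {o : O}
    (ho : o ∈ freeItems β X i) (hk : o ∈ X k) : IsPath β X i k [o] o o :=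
  ⟨rfl, rfl, by simp, by simp, ho, hk⟩

/-- Items of `X^0_h` are unallocated in `X^c`. As no Pareto-improving path exists, none of them is
free for `h` or reached by an edge from the path, so `le_rank` applies with all path items of the
bundle in `E` and has no defect. -/
theorem IsDecomposed.exchange (hβc : ∀ h, IsRank (βc h)) (hβ0 : ∀ h, IsRank (β0 h))
    (hq : ∀ h S T, S ⊆ T → βc h T + β0 h S ≤ β0 h T + βc h S)
    (hD : IsDecomposed βc β0 Xc X0) (hno : ∀ i, ¬ HasPath βc Xc i none) {j : Fin n}
    (hji : j ≠ i) (hP : IsMinWeightPath βc Xc X0 i (some j) P a b) :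
    IsDecomposed βc β0 (augment Xc i P a b) X0 := by
  have hk : some j ≠ some i := fun h => hji (Option.some.inj h)
  have hS := hP.isShortest_some hD.allocC hD.disj
  have hnone : augment Xc i P a b none = Xc none := by
    rw [augment_none hβc hD.allocC hD.cleanC hP.1]
    exact Finset.erase_eq_of_notMem (hP.1.not_mem_none hD.allocC b hP.1.last_mem)
  refine ⟨isAllocation_augment hβc hD.allocC hD.cleanC hP.1,
    isClean_augment hβc hD.allocC hD.cleanC hS hk, hD.alloc0, ?_, ?_⟩
  · intro h o ho
    rw [hnone]
    exact hD.disj h o ho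
  · intro h
    have h1 := hD.le_rank hβc hβ0 hq hS hk (h := h) (E := Xc (some h) ∩ P.toFinset)
      (fun s hs hf => hno h ⟨_, _, _, hasPath_of_free hf (hD.disj h s hs)⟩)
      (by
        intro o ho
        rw [Finset.mem_inter, List.mem_toFinset] at ho
        refine ⟨ho.1, fun s hs hE => ?_⟩
        obtain ⟨p, hp, rfl⟩ := List.mem_iff_getElem.1 ho.2
        refine hno i ⟨_, _, _, hP.1.extend hp hE ?_ (hD.disj h s hs)⟩
        exact fun h' => hP.1.not_mem_none hD.allocC s (List.mem_of_mem_take h') (hD.disj h s hs))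
    rw [Finset.inter_assoc, Finset.inter_self, Finset.sdiff_inter_self_left] at h1
    have h2 := (hβ0 h).le_card (augment Xc i P a b (some h) ∪ X0 (some h))
    have h3 := Finset.card_union_le (augment Xc i P a b (some h)) (X0 (some h))
    omega

/-- The allocation `X^0` after the item `b` was given away. -/
theorem isAllocation_release (h0 : IsAllocation X0) (b : O) :
    IsAllocation (fun k => if k = none then insert b (X0 k) else (X0 k).erase b) := by
  intro o
  by_cases hob : o = b
  · subst hob
    refine ⟨none, by simp, ?_⟩
    intro k hk
    by_contra hne
    simp [hne] at hk
  · obtain ⟨k, hk, huniq⟩ := h0 o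
    have key : ∀ k', o ∈ (if k' = none then insert b (X0 k') else (X0 k').erase b) ↔
        o ∈ X0 k' := by
      intro k'
      split_ifs <;> simp [hob]
    exact ⟨k, (key k).2 hk, fun k' hk' => huniq k' ((key k').1 hk')⟩

theorem IsDecomposed.pareto (hβc : ∀ h, IsRank (βc h)) (hβ0 : ∀ h, IsRank (β0 h))
    (hq : ∀ h S T, S ⊆ T → βc h T + β0 h S ≤ β0 h T + βc h S)
    (hD : IsDecomposed βc β0 Xc X0) (hP : IsMinWeightPath βc Xc X0 i none P a b)
    (ht : RespectsTies βc Xc X0 i P) :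
    IsDecomposed βc β0 (augment Xc i P a b)
      (fun k => if k = none then insert b (X0 k) else (X0 k).erase b) := by
  have hS := hP.isShortest_none hD.allocC hD.disj
  refine ⟨isAllocation_augment hβc hD.allocC hD.cleanC hP.1,
    isClean_augment hβc hD.allocC hD.cleanC hS (by simp), isAllocation_release hD.alloc0 b,
    ?_, ?_⟩
  · intro h o ho
    simp only [reduceCtorEq, if_false, Finset.mem_erase] at ho
    rw [augment_none hβc hD.allocC hD.cleanC hP.1]
    exact Finset.mem_erase.2 ⟨ho.1, hD.disj h o ho.2⟩
  intro h
  simp only [reduceCtorEq, if_false]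
  set J := augment Xc i P a b (some h) with hJdef
  -- If nothing enters from outside of `X^c_h ∪ X^0_h`, heredity suffices. Otherwise an outside item
  -- `z` shows below that no item of `X^0_h` is free for `h`.
  by_cases htriv : J ⊆ Xc (some h) ∪ X0 (some h)
  · exact (hβ0 h).indep_subset (Finset.union_subset htriv
      ((Finset.erase_subset _ _).trans Finset.subset_union_right)) (hD.indep h)
  have hlast := fun x s => hP.last_edge hD.allocC hD.disj (h := h) (x := x) (s := s)
  have hspan : ∀ s ∈ X0 (some h), s ∉ freeItems βc Xc h := by
    rw [Finset.not_subset] at htriv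
    obtain ⟨z, hzJ, hz⟩ := htriv
    rw [Finset.mem_union, not_or] at hz
    intro s hs hf
    rcases (mem_augment hβc hD.allocC hD.cleanC hP.1).1 hzJ with h1 | ⟨h1, rfl⟩ | ⟨x, hx, hxz⟩
    · exact hz.1 h1.1
    · obtain rfl := Option.some.inj h1
      -- A free item of `X^0_i` is itself a path, so `P` is a single item, and the tie rule puts it
      -- into `X^0_i`.
      have h2 := hS.2 _ _ _ (hasPath_of_free hf (hD.disj h s hs))
      have h3 := hP.1.getElem_zero
      have h4 := hP.1.length_pos
      rw [List.length_singleton] at h2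
      obtain ⟨w, rfl⟩ := List.length_eq_one_iff.1 (le_antisymm h2 h4)
      obtain rfl : w = z := h3
      exact hz.2 (ht w rfl ⟨s, hs, hf⟩)
    · have hxP := hP.1.mem_iff_out_or_last.2 (Or.inl ⟨z, hxz⟩)
      -- With such an edge `last_edge` would give `z = b ∈ X^0_h`. Without it `X^c_h - x` spans `s`,
      -- so `s` is not free.
      have hno : ¬ ExchangeEdge βc Xc x s := by
        intro hE
        obtain ⟨h1, h2⟩ := hlast x s hxP hx hs hE
        obtain ⟨p, hp, h3, h4⟩ := mem_zip_tail_iff.1 h1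
        obtain ⟨q, hq', h5, h6⟩ := mem_zip_tail_iff.1 hxz
        have h7 : p = q := (hP.1.2.2.1.getElem_inj_iff).1 (h3.trans h5.symm)
        subst h7
        exact hz.2 ((h6.symm.trans h4) ▸ h2)
      have h1 := (hβc h).insert_eq_of_ne (hD.cleanC h) hx
        fun he => hno ((edge_iff hD.allocC hx).2 he)
      have h2 := (hβc h).submod _ _ s (Finset.erase_subset x (Xc (some h)))
      have h3 : βc h (insert s (Xc (some h))) = βc h (Xc (some h)) + 1 := hf
      omega
  classical
  set E := (Xc (some h)).filter fun o => ∀ s ∈ X0 (some h), ¬ ExchangeEdge βc Xc o s with hEdef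
  have h1 := hD.le_rank hβc hβ0 hq hS (by simp) hspan (E := E)
    (fun o ho => by rw [hEdef, Finset.mem_filter] at ho; exact ho)
  rw [← hJdef] at h1
  -- Only the predecessor of `b` can lie outside `E`. It costs one in `le_rank`, but then `b`
  -- belongs to both `J` and `X^0_h`, and removing `b` from `X^0_h` regains the one.
  by_cases hfull : ∃ x ∈ Xc (some h), x ∈ P ∧ x ∉ E
  · obtain ⟨x, hx, hxP, hxE⟩ := hfull
    have hxs : ∃ s ∈ X0 (some h), ExchangeEdge βc Xc x s := by
      by_contra hcon
      push Not at hcon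
      exact hxE (Finset.mem_filter.2 ⟨hx, hcon⟩)
    obtain ⟨s, hs, hE⟩ := hxs
    obtain ⟨hxb, hb⟩ := hlast x s hxP hx hs hE
    have hbJ : b ∈ J := (mem_augment hβc hD.allocC hD.cleanC hP.1).2 (Or.inr (Or.inr ⟨x, hx, hxb⟩))
    have h2 : Xc (some h) \ (E ∩ P.toFinset) ⊆ insert x (Xc (some h) \ P.toFinset) := by
      intro o ho
      simp only [Finset.mem_sdiff, Finset.mem_inter, List.mem_toFinset, Finset.mem_insert] at ho ⊢
      by_cases hoP : o ∈ P
      · left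
        have hoE : o ∉ E := fun h' => ho.2 ⟨h', hoP⟩
        have : ∃ s ∈ X0 (some h), ExchangeEdge βc Xc o s := by
          by_contra hcon
          push Not at hcon
          exact hoE (Finset.mem_filter.2 ⟨ho.1, hcon⟩)
        obtain ⟨s', hs', hE'⟩ := this
        exact hP.1.pred_unique (hlast o s' hoP ho.1 hs' hE').1 hxb
      · exact Or.inr ⟨ho.1, hoP⟩
    have h3 := (Finset.card_le_card h2).trans (Finset.card_insert_le _ _)
    have h4 : J ∪ (X0 (some h)).erase b = J ∪ X0 (some h) := by
      ext o
      simp only [Finset.mem_union, Finset.mem_erase]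
      have : o = b → o ∈ J := by rintro rfl; exact hbJ
      tauto
    have h5 := Finset.card_union_le J ((X0 (some h)).erase b)
    have h6 := Finset.card_erase_add_one hb
    have h7 := (hβ0 h).le_card (J ∪ (X0 (some h)).erase b)
    rw [h4] at h5 h7 ⊢
    omega
  · push Not at hfull
    have h2 : Xc (some h) \ (E ∩ P.toFinset) = Xc (some h) \ P.toFinset := by
      ext o
      simp only [Finset.mem_sdiff, Finset.mem_inter, List.mem_toFinset]
      have := hfull o
      tauto
    rw [h2] at h1
    have h3 := (hβ0 h).le_card (J ∪ X0 (some h))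
    have h4 := Finset.card_union_le J (X0 (some h))
    exact (hβ0 h).indep_subset (Finset.union_subset_union_right (Finset.erase_subset _ _))
      (T := J ∪ X0 (some h)) (by omega)

end PhaseTwo

/-! ### Existence of optimal paths -/

section Exists

variable {O : Type*} [DecidableEq O] [Fintype O] {n : ℕ} {β : Fin n → Finset O → ℕ}
  {X X0 : Bundles n O} {i : Fin n} {k : Option (Fin n)}

theorem finite_nodup_lists : {l : List O | l.Nodup}.Finite :=
  @Set.toFinite _ _ (@Finite.of_fintype _ fintypeNodupList)

theorem HasPath.exists_min {α : Type*} [LinearOrder α] (h : HasPath β X i k) (f : List O → α) :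
    ∃ P a b, IsPath β X i k P a b ∧ ∀ Q a' b', IsPath β X i k Q a' b' → f P ≤ f Q := by
  obtain ⟨P, ⟨a, b, hP⟩, hmin⟩ := Set.exists_min_image {P | ∃ a b, IsPath β X i k P a b} f
    (finite_nodup_lists.subset fun P ⟨a, b, hP⟩ => hP.2.2.1) h
  exact ⟨P, a, b, hP, fun Q a' b' hQ => hmin Q ⟨a', b', hQ⟩⟩

/-- All single-item paths have weight `0`, so one that violates the tie rule can be replaced by a
free item of `X^0_i`. -/
theorem HasPath.exists_respecting (hd : ∀ h, ∀ o ∈ X0 (some h), o ∈ X none)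
    (h : HasPath β X i none) :
    ∃ P a b, IsMinWeightPath β X X0 i none P a b ∧ RespectsTies β X X0 i P := by
  obtain ⟨P, a, b, hP, hmin⟩ := h.exists_min (pathWeight X X0)
  by_cases ht : RespectsTies β X X0 i P
  · exact ⟨P, a, b, ⟨hP, hmin⟩, ht⟩
  · unfold RespectsTies at ht
    push Not at ht
    obtain ⟨o, rfl, ⟨o', ho', hf⟩, -⟩ := ht
    refine ⟨[o'], o', o', ⟨hasPath_of_free hf (hd i o' ho'), ?_⟩, ?_⟩
    · intro Q a' b' hQ
      have := hmin Q a' b' hQ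
      rwa [pathWeight_singleton] at this ⊢
    · intro x hx _
      obtain rfl : o' = x := by simpa using hx
      exact ho'

end Exists

/-! ### Invariants of the algorithm -/

section Algorithm

variable {O : Type*} [DecidableEq O] [Fintype O] {n : ℕ} {c : ℝ} {v : Fin n → Finset O → ℝ}

theorem isAllocation_empty : IsAllocation (emptyAllocation : Bundles n O) := by
  intro o
  refine ⟨none, by simp [emptyAllocation], ?_⟩
  rintro (_ | h) hh
  · rfl
  · simp [emptyAllocation] at hh

theorem isClean_empty {β : Fin n → Finset O → ℕ} (hβ : ∀ h, IsRank (β h)) :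
    IsClean β (emptyAllocation : Bundles n O) := fun h => by
  simp [emptyAllocation, (hβ h).empty]

theorem sum_card {Y : Bundles n O} (hY : IsAllocation Y) :
    ∑ h, (Y (some h)).card + (Y none).card = Fintype.card O := by
  have := sum_card_inter hY Finset.univ
  simpa using this

/-- `X` maximizes the total rank among all allocations. -/
def IsMaxRank (β : Fin n → Finset O → ℕ) (X : Bundles n O) : Prop :=
  ∀ Y : Bundles n O, IsAllocation Y → ∑ h, β h (Y (some h)) ≤ ∑ h, β h (X (some h))

/-- The invariant of the second phase: the allocations are decomposed, and the number of items
allocated by `X^c` and `X^0` is at least the maximum total rank with respect to `β^0`. -/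
structure PhaseTwoInv (βc β0 : Fin n → Finset O → ℕ) (s : Triple n O) : Prop where
  decomposed : IsDecomposed βc β0 s.Xc s.X0
  bound : ∀ Y : Bundles n O, IsAllocation Y →
    ∑ h, β0 h (Y (some h)) + (s.Xc none ∩ s.X0 none).card ≤ Fintype.card O
  minus : s.Xm = emptyAllocation

/-- The invariant of the states of the algorithm. -/
def StateInv (c : ℝ) (v : Fin n → Finset O → ℝ) : State n O → Prop
  | .yankee X U => IsAllocation X ∧ IsClean (fun h => beta 0 (v h)) X ∧
      ∀ i, i ∉ U → ¬ HasPath (fun h => beta 0 (v h)) X i none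
  | .pareto s _ => PhaseTwoInv (fun h => beta c (v h)) (fun h => beta 0 (v h)) s
  | .exchange s _ => PhaseTwoInv (fun h => beta c (v h)) (fun h => beta 0 (v h)) s ∧
      ∀ i, ¬ HasPath (fun h => beta c (v h)) s.Xc i none
  | .greedy s => IsAllocation s.total ∧ IsMaxRank (fun h => beta c (v h)) s.total ∧
      IsMaxRank (fun h => beta 0 (v h)) s.total
  | .done X => IsMaxUSW v X

/-- Completeness makes the bundle sizes add up to the constant `|O|`. -/
theorem usw_eq (hc : 0 < c) (hv : ∀ i, IsONSub ({-1, 0, c} : Set ℝ) (v i)) {Y : Bundles n O}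
    (hY : IsCompleteAllocation Y) :
    usw v Y = c * (∑ h, beta c (v h) (Y (some h)) : ℕ) + (∑ h, beta 0 (v h) (Y (some h)) : ℕ)
      - Fintype.card O := by
  have h1 := sum_card hY.1
  rw [hY.2, Finset.card_empty, add_zero] at h1
  rw [← h1]
  push_cast
  rw [Finset.mul_sum, ← Finset.sum_add_distrib, ← Finset.sum_sub_distrib]
  exact Finset.sum_congr rfl fun h _ => valuation_eq hc (hv h) _

theorem isMaxUSW_of_isMaxRank (hc : 0 < c) (hv : ∀ i, IsONSub ({-1, 0, c} : Set ℝ) (v i))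
    {X : Bundles n O} (hX : IsCompleteAllocation X) (hXc : IsMaxRank (fun h => beta c (v h)) X)
    (hX0 : IsMaxRank (fun h => beta 0 (v h)) X) : IsMaxUSW v X := by
  refine ⟨hX, fun Y hY => ?_⟩
  rw [usw_eq hc hv hX, usw_eq hc hv hY]
  have h1 : ((∑ h, beta c (v h) (Y (some h)) : ℕ) : ℝ) ≤ (∑ h, beta c (v h) (X (some h)) : ℕ) :=
    Nat.cast_le.2 (hXc Y hY.1)
  have h2 : ((∑ h, beta 0 (v h) (Y (some h)) : ℕ) : ℝ) ≤ (∑ h, beta 0 (v h) (X (some h)) : ℕ) :=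
    Nat.cast_le.2 (hX0 Y hY.1)
  have h3 := mul_le_mul_of_nonneg_left h1 hc.le
  linarith

theorem total_of_empty {s : Triple n O} (h : s.Xm = emptyAllocation) :
    s.total = unionAlloc s.Xc s.X0 := by
  funext k
  cases k <;> simp [Triple.total, unionAlloc, h, emptyAllocation]

theorem IsDecomposed.isAllocation_union {βc β0 : Fin n → Finset O → ℕ} {Xc X0 : Bundles n O}
    (hD : IsDecomposed βc β0 Xc X0) : IsAllocation (unionAlloc Xc X0) := by
  intro o
  obtain ⟨k, hk, -⟩ := hD.allocC o
  obtain ⟨k0, hk0, -⟩ := hD.alloc0 o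
  rcases k with _ | h
  · refine ⟨k0, ?_, ?_⟩
    · rcases k0 with _ | h0
      · exact Finset.mem_inter.2 ⟨hk, hk0⟩
      · exact Finset.mem_union_right _ hk0
    · rintro (_ | h') hh'
      · exact hD.alloc0.eq (Finset.mem_inter.1 hh').2 hk0
      · rcases Finset.mem_union.1 hh' with h1 | h1
        · cases hD.allocC.eq hk h1
        · exact hD.alloc0.eq h1 hk0
  · refine ⟨some h, Finset.mem_union_left _ hk, ?_⟩
    rintro (_ | h') hh'
    · cases hD.allocC.eq hk (Finset.mem_inter.1 hh').1
    · rcases Finset.mem_union.1 hh' with h1 | h1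
      · exact hD.allocC.eq h1 hk
      · cases hD.allocC.eq hk (hD.disj h' o h1)

/-- `X^c` alone already has maximum `∑ β^c`, and adding `X^0` cannot lower it. The union is
independent for `β^0`, so its `∑ β^0` counts the allocated items, which `bound` shows to be enough.
-/
theorem PhaseTwoInv.greedy {βc β0 : Fin n → Finset O → ℕ} (hβc : ∀ h, IsRank (βc h))
    {s : Triple n O} (hs : PhaseTwoInv βc β0 s) (hno : ∀ i, ¬ HasPath βc s.Xc i none) :
    IsAllocation s.total ∧ IsMaxRank βc s.total ∧ IsMaxRank β0 s.total := by
  rw [total_of_empty hs.minus]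
  have hA := hs.decomposed.isAllocation_union
  refine ⟨hA, ?_, ?_⟩
  · intro Y hY
    refine (sum_rank_le hβc hs.decomposed.allocC hs.decomposed.cleanC hno hY).trans ?_
    refine Finset.sum_le_sum fun h _ => ?_
    rw [← hs.decomposed.cleanC h]
    exact (hβc h).mono Finset.subset_union_left
  · intro Y hY
    have h1 := hs.bound Y hY
    have h2 := sum_card hA
    have h3 : ∑ h, β0 h (unionAlloc s.Xc s.X0 (some h)) =
        ∑ h, (unionAlloc s.Xc s.X0 (some h)).card :=
      Finset.sum_congr rfl fun h _ => hs.decomposed.indep h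
    have h4 : unionAlloc s.Xc s.X0 none = s.Xc none ∩ s.X0 none := rfl
    rw [h4] at h2
    omega

/-- The bundles after the unallocated item `o` was given to the agent `i`. -/
theorem total_give (s : Triple n O) (i : Fin n) (o : O) :
    Triple.total ⟨s.Xc, s.X0, fun k => if k = some i then insert o (s.Xm k)
      else if k = none then (s.Xm k).erase o else s.Xm k⟩ =
    fun k => if k = some i then insert o (s.total k)
      else if k = none then (s.total k).erase o else s.total k := by
  funext k
  rcases k with _ | h
  · simp [Triple.total, unionAlloc, Finset.inter_erase]
  · by_cases hh : h = i
    · simp [Triple.total, unionAlloc, hh]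
    · simp [Triple.total, unionAlloc, hh]

theorem isAllocation_give {X : Bundles n O} (hX : IsAllocation X) (i : Fin n) {o : O}
    (ho : o ∈ X none) : IsAllocation (fun k => if k = some i then insert o (X k)
      else if k = none then (X k).erase o else X k) := by
  intro x
  by_cases hxo : x = o
  · subst hxo
    refine ⟨some i, by simp, ?_⟩
    intro k hk
    by_contra hne
    by_cases hk0 : k = none
    · simp [hk0] at hk
    · simp only [hne, hk0, if_false] at hk
      exact hk0 (hX.eq hk ho)
  · obtain ⟨k, hk, huniq⟩ := hX x
    have key : ∀ k', x ∈ (if k' = some i then insert o (X k')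
        else if k' = none then (X k').erase o else X k') ↔ x ∈ X k' := by
      intro k'
      split_ifs <;> simp [hxo]
    exact ⟨k, (key k).2 hk, fun k' hk' => huniq k' ((key k').1 hk')⟩

/-- Agents' bundles only grow, so for welfare it does not matter who receives the item. -/
theorem isMaxRank_give {β : Fin n → Finset O → ℕ} (hβ : ∀ h, IsRank (β h)) {X : Bundles n O}
    (hX : IsMaxRank β X) (i : Fin n) (o : O) :
    IsMaxRank β (fun k => if k = some i then insert o (X k)
      else if k = none then (X k).erase o else X k) := by
  intro Y hY
  refine (hX Y hY).trans (Finset.sum_le_sum fun h _ => ?_)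
  apply (hβ h).mono
  dsimp only
  split_ifs <;> simp_all

theorem stateInv_step (hc : 0 < c) (hv : ∀ i, IsONSub ({-1, 0, c} : Set ℝ) (v i))
    {s s' : State n O} (hs : StateInv c v s) (hstep : Step c v s s') : StateInv c v s' := by
  have hβc : ∀ h, IsRank ((fun h => beta c (v h)) h) := fun h => isRank_beta (hv h) c
  have hβ0 : ∀ h, IsRank ((fun h => beta 0 (v h)) h) := fun h => isRank_beta (hv h) 0
  have hq : ∀ h S T, S ⊆ T → (fun h => beta c (v h)) h T + (fun h => beta 0 (v h)) h S ≤
      (fun h => beta 0 (v h)) h T + (fun h => beta c (v h)) h S :=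
    fun h S T hST => beta_quotient (hv h) hc.le S T hST
  cases hstep with
  | yankeeAugment X U i P a b hi hP =>
    obtain ⟨h1, h2, h3⟩ := hs
    exact ⟨isAllocation_augment hβ0 h1 h2 hP.1, isClean_augment hβ0 h1 h2 hP (by simp),
      fun j hj => not_hasPath_augment hβ0 h1 h2 hP (h3 j hj)⟩
  | yankeeRemove X U i hi hP =>
    obtain ⟨h1, h2, h3⟩ := hs
    refine ⟨h1, h2, fun j hj => ?_⟩
    by_cases hji : j = i
    · exact hji ▸ hP
    · exact h3 j fun h => hj (Finset.mem_erase.2 ⟨hji, h⟩)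
  | yankeeEnd X =>
    obtain ⟨h1, h2, h3⟩ := hs
    refine ⟨⟨isAllocation_empty, isClean_empty hβc, h1, fun _ _ _ => by simp [emptyAllocation],
      fun h => by simpa [emptyAllocation] using h2 h⟩, fun Y hY => ?_, rfl⟩
    have h4 := sum_rank_le hβ0 h1 h2 (fun i => h3 i (by simp)) hY
    have h5 := sum_card h1
    simp only [emptyAllocation, Finset.univ_inter]
    omega
  | paretoAugment s changed i P a b hP ht =>
    refine ⟨hs.decomposed.pareto hβc hβ0 hq hP ht, fun Y hY => ?_, hs.minus⟩
    -- Although `b` becomes unallocated in `X^0`, it is now allocated in `X^c`, so no item becomes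
    -- unallocated in both.
    refine le_trans (Nat.add_le_add_left (Finset.card_le_card ?_) _) (hs.bound Y hY)
    simp only [if_true]
    rw [augment_none hβc hs.decomposed.allocC hs.decomposed.cleanC hP.1]
    intro o
    simp only [Finset.mem_inter, Finset.mem_erase, Finset.mem_insert]
    tauto
  | paretoEnd s changed hP => exact ⟨hs, hP⟩
  | exchangeAugment s changed i j P a b hij hP =>
    obtain ⟨hs, hno⟩ := hs
    refine ⟨hs.decomposed.exchange hβc hβ0 hq hno hij.1 hP, fun Y hY => ?_, hs.minus⟩
    refine le_trans (Nat.add_le_add_left (Finset.card_le_card ?_) _) (hs.bound Y hY)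
    dsimp only
    rw [augment_none hβc hs.decomposed.allocC hs.decomposed.cleanC hP.1]
    exact Finset.inter_subset_inter_right (Finset.erase_subset _ _)
  | exchangeNone s hij => exact hs.1
  | exchangeEnd s hij => exact hs.1.greedy hβc hs.2
  | greedyGive s i o hi ho =>
    obtain ⟨h1, h2, h3⟩ := hs
    simp only [StateInv]
    rw [total_give]
    exact ⟨isAllocation_give h1 i ho, isMaxRank_give hβc h2 i o, isMaxRank_give hβ0 h3 i o⟩
  | greedyEnd s ho =>
    obtain ⟨h1, h2, h3⟩ := hs
    exact isMaxUSW_of_isMaxRank hc hv ⟨h1, ho⟩ h2 h3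

/-! ### Progress -/

theorem exists_greedyChoice (hn : 0 < n) (v : Fin n → Finset O → ℝ) (X : Bundles n O) :
    ∃ i, IsGreedyChoice v X i := by
  classical
  have : Nonempty (Fin n) := ⟨⟨0, hn⟩⟩
  obtain ⟨m, -, hm⟩ := Finset.exists_max_image Finset.univ (fun h => v h (X (some h)))
    Finset.univ_nonempty
  obtain ⟨i, hi, hmax⟩ := Finset.exists_max_image
    (Finset.univ.filter fun h => v h (X (some h)) = v m (X (some m))) id ⟨m, by simp⟩
  have hi' := (Finset.mem_filter.1 hi).2
  refine ⟨i, fun h => hi' ▸ hm h (Finset.mem_univ h), fun h hh => ?_⟩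
  exact hmax h (Finset.mem_filter.2 ⟨Finset.mem_univ h, hh.trans hi'⟩)

theorem exists_step (hn : 0 < n) {s : State n O} (hs : StateInv c v s)
    (hd : ∀ X, s ≠ .done X) : ∃ s', Step c v s s' := by
  cases s with
  | yankee X U =>
    rcases U.eq_empty_or_nonempty with rfl | hU
    · exact ⟨_, Step.yankeeEnd X⟩
    · obtain ⟨i, hi, hmin⟩ := Finset.exists_min_image U
        (fun h => beta 0 (v h) (X (some h))) hU
      by_cases hP : HasPath (fun h => beta 0 (v h)) X i none
      · obtain ⟨P, a, b, h1, h2⟩ := hP.exists_min List.length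
        exact ⟨_, Step.yankeeAugment X U i P a b ⟨hi, hmin⟩ ⟨h1, h2⟩⟩
      · exact ⟨_, Step.yankeeRemove X U i ⟨hi, hmin⟩ hP⟩
  | pareto s changed =>
    by_cases hP : ∃ i, HasPath (fun h => beta c (v h)) s.Xc i none
    · obtain ⟨i, hi⟩ := hP
      obtain ⟨P, a, b, h1, h2⟩ := hi.exists_respecting hs.decomposed.disj
      exact ⟨_, Step.paretoAugment s changed i P a b h1 h2⟩
    · exact ⟨_, Step.paretoEnd s changed fun i hi => hP ⟨i, hi⟩⟩
  | exchange s changed =>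
    by_cases hP : ∃ i j, ExchangeAllowed (fun h => beta c (v h)) s.Xc i j
    · obtain ⟨i, j, hij⟩ := hP
      obtain ⟨P, a, b, h1, h2⟩ := hij.2.1.exists_min (pathWeight s.Xc s.X0)
      exact ⟨_, Step.exchangeAugment s changed i j P a b hij ⟨h1, h2⟩⟩
    · have hno : ∀ i j, ¬ ExchangeAllowed (fun h => beta c (v h)) s.Xc i j :=
        fun i j h => hP ⟨i, j, h⟩
      cases changed with
      | true => exact ⟨_, Step.exchangeNone s hno⟩
      | false => exact ⟨_, Step.exchangeEnd s hno⟩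
  | greedy s =>
    rcases (s.total none).eq_empty_or_nonempty with h | ⟨o, ho⟩
    · exact ⟨_, Step.greedyEnd s h⟩
    · obtain ⟨i, hi⟩ := exists_greedyChoice hn v s.total
      exact ⟨_, Step.greedyGive s i o hi ho⟩
  | done X => exact absurd rfl (hd X)

/-! ### Termination -/

/-- The sum of the squared bundle sizes. -/
def sizeSquares (X : Bundles n O) : ℕ := ∑ h, (X (some h)).card ^ 2

/-- The sum of the bundle sizes weighted with the indices of the agents. -/
def sizeIndices (X : Bundles n O) : ℕ := ∑ h : Fin n, h.val * (X (some h)).card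

/-- The termination measure of the algorithm. -/
def stateMeasure : State n O → ℕ ×ₗ ℕ ×ₗ ℕ ×ₗ ℕ ×ₗ ℕ
  | .yankee X U => toLex (3, toLex ((X none).card, toLex (U.card, toLex (0, 0))))
  -- For fixed `X^c` the last coordinate runs down `3, 2, 1, 0`: one pass that records a change,
  -- then one without.
  | .pareto s changed => toLex (2, toLex ((s.Xc none).card, toLex (sizeSquares s.Xc,
      toLex (sizeIndices s.Xc, 2 * changed.toNat + 1))))
  | .exchange s changed => toLex (2, toLex ((s.Xc none).card, toLex (sizeSquares s.Xc,
      toLex (sizeIndices s.Xc, 2 * changed.toNat))))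
  | .greedy s => toLex (1, toLex ((s.total none).card, toLex (0, toLex (0, 0))))
  | .done _ => toLex (0, toLex (0, toLex (0, toLex (0, 0))))

/-- Moving one unit from `j` to `i` changes the sum of squares by `2(|X_i| + 1 - |X_j|)` and the
index sum by `i - j`. -/
theorem size_decrease {X Y : Bundles n O} {i j : Fin n} (hji : j ≠ i)
    (hcard : ∀ h, (Y (some h)).card + (if some j = some h then 1 else 0) =
      (X (some h)).card + (if h = i then 1 else 0))
    (hij : (X (some i)).card + 1 < (X (some j)).card ∨
      ((X (some i)).card + 1 = (X (some j)).card ∧ i < j)) :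
    sizeSquares Y < sizeSquares X ∨
      (sizeSquares Y = sizeSquares X ∧ sizeIndices Y < sizeIndices X) := by
  have hcard' : ∀ h, ((Y (some h)).card : ℤ) =
      (X (some h)).card + (if h = i then 1 else 0) - (if h = j then 1 else 0) := by
    intro h
    have h1 := hcard h
    simp only [Option.some.injEq, @eq_comm _ j h] at h1
    split_ifs at h1 ⊢ <;> omega
  have hsq : (sizeSquares Y : ℤ) =
      sizeSquares X + (2 * (X (some i)).card + 1) + (1 - 2 * (X (some j)).card) := by
    have h1 : ∀ h, ((Y (some h)).card : ℤ) ^ 2 = ((X (some h)).card : ℤ) ^ 2 +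
        (if h = i then 2 * ((X (some i)).card : ℤ) + 1 else 0) +
        (if h = j then 1 - 2 * ((X (some j)).card : ℤ) else 0) := by
      intro h
      rw [hcard' h]
      by_cases hi : h = i
      · subst hi
        rw [if_pos rfl, if_pos rfl, if_neg hji.symm, if_neg hji.symm]; ring
      · by_cases hj : h = j
        · subst hj
          rw [if_neg hi, if_neg hi, if_pos rfl, if_pos rfl]; ring
        · simp [hi, hj]
    simp only [sizeSquares, Nat.cast_sum, Nat.cast_pow, h1, Finset.sum_add_distrib,
      Finset.sum_ite_eq', Finset.mem_univ, if_true]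
  have hidx : (sizeIndices Y : ℤ) = sizeIndices X + i.val - j.val := by
    have h1 : ∀ h : Fin n, (h.val : ℤ) * (Y (some h)).card = (h.val : ℤ) * (X (some h)).card +
        (if h = i then (i.val : ℤ) else 0) + (if h = j then -(j.val : ℤ) else 0) := by
      intro h
      rw [hcard' h]
      by_cases hi : h = i
      · subst hi
        rw [if_pos rfl, if_pos rfl, if_neg hji.symm, if_neg hji.symm]; ring
      · by_cases hj : h = j
        · subst hj
          rw [if_neg hi, if_neg hi, if_pos rfl, if_pos rfl]; ring
        · simp [hi, hj]
    simp only [sizeIndices, Nat.cast_sum, Nat.cast_mul, h1, Finset.sum_add_distrib,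
      Finset.sum_ite_eq', Finset.mem_univ, if_true]
    ring
  rcases hij with h | ⟨h, hlt⟩
  · left; omega
  · right
    have : i.val < j.val := hlt
    omega

theorem stateMeasure_step (hv : ∀ i, IsONSub ({-1, 0, c} : Set ℝ) (v i))
    {s s' : State n O} (hs : StateInv c v s) (hstep : Step c v s s') :
    stateMeasure s' < stateMeasure s := by
  have hβc : ∀ h, IsRank ((fun h => beta c (v h)) h) := fun h => isRank_beta (hv h) c
  have hβ0 : ∀ h, IsRank ((fun h => beta 0 (v h)) h) := fun h => isRank_beta (hv h) 0
  cases hstep with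
  | yankeeAugment X U i P a b hi hP =>
    have h1 := Finset.card_erase_lt_of_mem hP.1.2.2.2.2.2
    rw [← augment_none hβ0 hs.1 hs.2.1 hP.1] at h1
    simp [stateMeasure, Prod.Lex.toLex_lt_toLex, h1]
  | yankeeRemove X U i hi hP =>
    have h1 := Finset.card_erase_lt_of_mem hi.1
    simp [stateMeasure, Prod.Lex.toLex_lt_toLex, h1]
  | yankeeEnd X => simp [stateMeasure, Prod.Lex.toLex_lt_toLex]
  | paretoAugment s changed i P a b hP ht =>
    have h1 := Finset.card_erase_lt_of_mem hP.1.2.2.2.2.2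
    rw [← augment_none hβc hs.decomposed.allocC hs.decomposed.cleanC hP.1] at h1
    simp [stateMeasure, Prod.Lex.toLex_lt_toLex, h1]
  | paretoEnd s changed hP => simp [stateMeasure, Prod.Lex.toLex_lt_toLex]
  | exchangeAugment s changed i j P a b hij hP =>
    obtain ⟨hs, -⟩ := hs
    have hD := hs.decomposed
    have h1 := augment_none hβc hD.allocC hD.cleanC hP.1
    rw [Finset.erase_eq_of_notMem (hP.1.not_mem_none hD.allocC b hP.1.last_mem)] at h1
    have h2 := size_decrease hij.1 (fun h => (augment_card hβc hD.allocC hD.cleanC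
      (hP.isShortest_some hD.allocC hD.disj) (fun h' => hij.1 (Option.some.inj h')) h).2) hij.2.2
    simp only [stateMeasure, Prod.Lex.toLex_lt_toLex, h1]
    tauto
  | exchangeNone s hij => simp [stateMeasure, Prod.Lex.toLex_lt_toLex]
  | exchangeEnd s hij => simp [stateMeasure, Prod.Lex.toLex_lt_toLex]
  | greedyGive s i o hi ho =>
    have h1 := Finset.card_erase_lt_of_mem ho
    simp only [stateMeasure, Prod.Lex.toLex_lt_toLex]
    rw [total_give]
    simp only [reduceCtorEq, if_false, if_true]
    tauto
  | greedyEnd s ho => simp [stateMeasure, Prod.Lex.toLex_lt_toLex]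

theorem stateInv_start (hv : ∀ i, IsONSub ({-1, 0, c} : Set ℝ) (v i)) :
    StateInv c v (start : State n O) :=
  ⟨isAllocation_empty, isClean_empty fun h => isRank_beta (hv h) 0,
    fun i hi => absurd (Finset.mem_univ i) hi⟩

end Algorithm

end MixedManna

theorem mainTheorem7 {O : Type*} [Fintype O] [DecidableEq O] (n : ℕ) (hn : 0 < n)
    (c : ℕ) (hc : 0 < c) (v : Fin n → Finset O → ℝ)
    (hv : ∀ i, MixedManna.IsONSub ({-1, 0, (c : ℝ)} : Set ℝ) (v i)) :
    (¬ ∃ run : ℕ → MixedManna.State n O, run 0 = MixedManna.start ∧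
        ∀ t, MixedManna.Step (c : ℝ) v (run t) (run (t + 1))) ∧
      ∀ s : MixedManna.State n O,
        Relation.ReflTransGen (MixedManna.Step (c : ℝ) v) MixedManna.start s →
        (∀ s', ¬ MixedManna.Step (c : ℝ) v s s') →
        ∃ X : MixedManna.Bundles n O, s = .done X ∧ MixedManna.IsMaxUSW v X := by
  have hc' : (0 : ℝ) < c := Nat.cast_pos.2 hc
  constructor
  · rintro ⟨run, h0, hrun⟩
    have hinv : ∀ t, MixedManna.StateInv (c : ℝ) v (run t) := by
      intro t
      induction t with
      | zero => rw [h0]; exact MixedManna.stateInv_start hv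
      | succ t ih => exact MixedManna.stateInv_step hc' hv ih (hrun t)
    exact not_strictAnti_of_wellFoundedLT (fun t => MixedManna.stateMeasure (run t))
      (strictAnti_nat_of_succ_lt fun t => MixedManna.stateMeasure_step hv (hinv t) (hrun t))
  · intro s hs hterm
    have hinv : MixedManna.StateInv (c : ℝ) v s := by
      clear hterm
      induction hs with
      | refl => exact MixedManna.stateInv_start hv
      | tail _ hstep ih => exact MixedManna.stateInv_step hc' hv ih hstep
    by_contra hcon
    push Not at hcon
    -- Only `done` states lack a successor, and there the invariant is the optimality claim itself.
    obtain ⟨s', hs'⟩ := MixedManna.exists_step hn hinv fun X hX => by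
      subst hX
      exact hcon X rfl hinv
    exact hterm s' hs'
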